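/- Let $\Sigma\subset\mathbb{R}^n$ be a complete smooth fan in the lattice $\mathbb{Z}^n$ (dual basis $e^1,\dots,e^n$) with primitive ray generators $\rho_1,\dots,\rho_d$, admitting a strictly convex piecewise linear function with integral slopes. Let $X=\bigcup_\sigma X_\sigma\subset\mathbb{C}^d$, where $\sigma$ runs over the $n$-dimensional cones and $X_\sigma=\{z : z_i=0 \text{ if } \rho_i\notin\sigma\}$, and let $f=z_1+\cdots+z_d$. For $U\subseteq X$ open, let $\mathcal{A}^{0,q}(U)$ be the space of families of smooth $(0,q)$-forms on the sets $U\cap X_\sigma$ whose restrictions to $U\cap X_\sigma\cap X_\tau$ agree whenever $\dim (X_\sigma\cap X_\tau)=n-1$. Let $\mathrm{PV}_{\log}(U)=\bigoplus_{i,j}\mathcal{A}^{0,j}(U)\otimes\bigwedge^i\langle\tilde\theta_1,\dots,\tilde\theta_n\rangle$, where $\tilde\theta_k=\sum_{l=1}^d\langle\rho_l,e^k\rangle z_l\frac{\partial}{\partial z_l}$ is the global frame of relative log derivations; the $d\bar z_i$ and $\tilde\theta_k$ anticommute. Let $\mathrm{PV}_{\log,c}(X)\subset\mathrm{PV}_{\log}(X)$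 be the elements with compact support. With $g_k=\tilde\theta_k(f)=\sum_{l}\langle\rho_l,e^k\rangle z_l$, put $$\{f,-\}=\sum_k g_k\frac{\partial}{\partial\tilde\theta_k},\qquad \partial=\sum_k\tilde\theta_k\,\frac{\partial}{\partial\tilde\theta_k},\qquad \bar\partial_f=\bar\partial+\{f,-\},\qquad Q=\bar\partial+u\partial,\qquad Q_f=\bar\partial_f+u\partial,$$ where in $\partial$ the derivation $\tilde\theta_k$ acts on coefficients and $u$ is a formal variable. On $X\setminus\{0\}$ let $V_f=\frac{1}{\sum_k g_k\bar g_k}\sum_k\bar g_k\tilde\theta_k$, acting by multiplication. All commutators are graded commutators. Then: 1. $\bar\partial_f^2=0$ and $Q_f^2=0$, both operators preserve compact supports, and the inclusions $$(\mathrm{PV}_{\log,c}(X),\bar\partial_f)\hookrightarrow(\mathrm{PV}_{\log}(X),\bar\partial_f),\qquad (\mathrm{PV}_{\log,c}(X)[[u]],Q_f)\hookrightarrow(\mathrm{PV}_{\log}(X)[[u]],Q_f)$$ are quasi-isomorphisms. 2. $[\{f,-\},V_f]=1$ on $\mathrm{PV}_{\log}(X\setminus\{0\})$, and the operators $1+[\bar\partial,V_f]$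 on $\mathrm{PV}_{\log}(X\setminus\{0\})$ and $1+[Q,V_f]$ on $\mathrm{PV}_{\log}(X\setminus\{0\})[[u]]$ are invertible. 3. Let $\rho:\mathbb{C}^d\to\mathbb{R}$ be smooth with compact support and $\rho\equiv1$ near $0$. For $D=\bar\partial$ and for $D=Q$, the formulas $$T=\rho+[D,\rho]\,V_f\,\frac{1}{1+[D,V_f]},\qquad R=(1-\rho)\,V_f\,\frac{1}{1+[D,V_f]}$$ on $X\setminus\{0\}$, extended over the origin by $T\alpha=\alpha$ and $R\alpha=0$ there, define operators $T_\rho,R_\rho$ on $\mathrm{PV}_{\log}(X)$ (for $D=\bar\partial$) and $T^u_\rho,R^u_\rho$ on $\mathrm{PV}_{\log}(X)[[u]]$ (for $D=Q$). $T_\rho$ takes values in $\mathrm{PV}_{\log,c}(X)$ and $T^u_\rho$ in $\mathrm{PV}_{\log,c}(X)[[u]]$; $R_\rho$ and $R^u_\rho$ preserve these subspaces; and $$[\bar\partial_f,R_\rho]=1-T_\rho,\qquad [Q_f,R^u_\rho]=1-T^u_\rho.$$ -/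

import Mathlib

open scoped TensorProduct ContDiff

namespace LogLG

/-! ### Differential modules and quasi-isomorphisms -/

section Cohomology

variable {V : Type*} [AddCommGroup V] [Module ℂ V]

/-- The cohomology `(C ∩ ker D) / D(C)` of a subcomplex `C` of the complex `(V, D)`. It is meaningful
when `D ∘ D = 0` and `D` maps `C` into `C`. -/
abbrev Cohomology (D : V →ₗ[ℂ] V) (C : Submodule ℂ V) : Type _ :=
  (C ⊓ LinearMap.ker D : Submodule ℂ V) ⧸
    (C.map D).comap (C ⊓ LinearMap.ker D : Submodule ℂ V).subtype

/-- The map induced on cohomology by an inclusion `C ⊆ C'` of subcomplexes of `(V, D)`. -/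
def Cohomology.ofLe (D : V →ₗ[ℂ] V) {C C' : Submodule ℂ V} (h : C ≤ C') :
    Cohomology D C →ₗ[ℂ] Cohomology D C' :=
  Submodule.mapQ _ _ (Submodule.inclusion (inf_le_inf_right _ h)) (by
    intro x hx
    exact Submodule.map_mono h hx)

/-- `(V, D)` is a complex, `C` is a subcomplex, and the inclusion `(C, D) ↪ (V, D)` is a
quasi-isomorphism. -/
def InclusionIsQuasiIso (D : V →ₗ[ℂ] V) (C : Submodule ℂ V) : Prop :=
  D ∘ₗ D = 0 ∧ (∀ x ∈ C, D x ∈ C) ∧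
    Function.Bijective (Cohomology.ofLe D (le_top : C ≤ ⊤))

/-- The (super)commutator `[A, B] = AB + BA` of two odd operators. -/
def oddComm (A B : Module.End ℂ V) : Module.End ℂ V := A * B + B * A

end Cohomology

/-! ### Fans -/

/-- The cone in `ℝⁿ` spanned by the integral vectors `v i`, `i ∈ σ`. -/
def rayCone {n d : ℕ} (v : Fin d → Fin n → ℤ) (σ : Finset (Fin d)) : Set (Fin n → ℝ) :=
  {x | ∃ c : Fin d → ℝ, (∀ i, 0 ≤ c i) ∧ x = fun k => ∑ i ∈ σ, c i * (v i k : ℝ)}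

/-- A complete smooth fan in `ℤⁿ` with `d` rays, whose toric variety is projective. A cone is
recorded by the set of (indices of) its rays. -/
structure ProjFan (n d : ℕ) where
  /-- the primitive generators `ρ_1, …, ρ_d` of the one-dimensional cones -/
  ray : Fin d → Fin n → ℤ
  /-- the cones -/
  cones : Set (Finset (Fin d))
  mem_of_subset : ∀ σ ∈ cones, ∀ τ ⊆ σ, τ ∈ cones
  singleton_mem : ∀ i, {i} ∈ cones
  /-- every cone is generated by a part of a lattice basis -/
  smooth : ∀ σ ∈ cones, ∃ (b : Module.Basis (Fin n) ℤ (Fin n → ℤ)) (e : σ ↪ Fin n),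
    ∀ i : σ, b (e i) = ray i
  /-- two cones meet in their common face -/
  inter : ∀ σ ∈ cones, ∀ τ ∈ cones, rayCone ray σ ∩ rayCone ray τ = rayCone ray (σ ∩ τ)
  complete : ∀ x : Fin n → ℝ, ∃ σ ∈ cones, x ∈ rayCone ray σ
  /-- there is a strictly convex piecewise linear function with integral slopes -/
  projective : ∃ ψ : (Fin n → ℝ) → ℝ, ∀ σ ∈ cones, σ.card = n → ∃ m : Fin n → ℤ,
    (∀ x ∈ rayCone ray σ, ψ x = ∑ k, (m k : ℝ) * x k) ∧
    (∀ x ∉ rayCone ray σ, ∑ k, (m k : ℝ) * x k < ψ x)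

/-- The `n`-dimensional cones `σ`; they index the irreducible components
`X_σ = {z ∈ ℂᵈ | z_i = 0 for i ∉ σ} ≅ ℂ^σ` of the central fibre `X ⊆ ℂᵈ`. -/
abbrev ProjFan.MaxCone {n d : ℕ} (F : ProjFan n d) : Type :=
  {σ : Finset (Fin d) // σ ∈ F.cones ∧ σ.card = n}

noncomputable section

variable {n d : ℕ}

/-! ### Smooth functions on coordinate subspaces -/

/-- The embedding `ℂ^σ → ℂᵈ` of a coordinate subspace. -/
def ext (σ : Finset (Fin d)) : (σ → ℂ) →L[ℝ] (Fin d → ℂ) :=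
  ContinuousLinearMap.pi fun i =>
    if h : i ∈ σ then ContinuousLinearMap.proj (⟨i, h⟩ : σ) else 0

/-- The projection `ℂᵈ → ℂ^σ`. -/
def proj (σ : Finset (Fin d)) : (Fin d → ℂ) →L[ℝ] (σ → ℂ) :=
  ContinuousLinearMap.pi fun i => ContinuousLinearMap.proj (i : Fin d)

/-- The open part `ℂ^σ ∩ Ω` of the coordinate subspace `ℂ^σ`. -/
def dom (Ω : TopologicalSpace.Opens (Fin d → ℂ)) (σ : Finset (Fin d)) :
    TopologicalSpace.Opens (σ → ℂ) :=
  Ω.comap ⟨ext σ, (ext σ).continuous⟩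

/-- `C^∞(U, ℂ)` for an open set `U ⊆ ℂ^σ`; a function on `U` is recorded by its extension by zero
to `ℂ^σ` (which need not be continuous). -/
def Smooth {σ : Finset (Fin d)} (U : TopologicalSpace.Opens (σ → ℂ)) :
    Submodule ℂ ((σ → ℂ) → ℂ) where
  carrier := {f | ContDiffOn ℝ ∞ f U ∧ ∀ w ∉ U, f w = 0}
  zero_mem' := ⟨contDiffOn_const, fun _ _ => rfl⟩
  add_mem' := fun {f g} hf hg => ⟨hf.1.add hg.1, fun w hw => by simp [hf.2 w hw, hg.2 w hw]⟩
  smul_mem' := fun c f hf => ⟨hf.1.const_smul c, fun w hw => by simp [hf.2 w hw]⟩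

section Local

variable {σ : Finset (Fin d)} {U : TopologicalSpace.Opens (σ → ℂ)}

lemma smooth_contDiffAt (f : Smooth U) {w : σ → ℂ} (hw : w ∈ U) : ContDiffAt ℝ ∞ f.1 w :=
  f.2.1.contDiffAt (U.isOpen.mem_nhds hw)

lemma smooth_differentiableAt (f : Smooth U) {w : σ → ℂ} (hw : w ∈ U) :
    DifferentiableAt ℝ f.1 w :=
  (smooth_contDiffAt f hw).differentiableAt (by simp)

/-- Multiplication by a function `χ` that is smooth on `U`. -/
def mulFun (χ : (σ → ℂ) → ℂ) (hχ : ContDiffOn ℝ ∞ χ U) : Smooth U →ₗ[ℂ] Smooth U where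
  toFun f := ⟨fun w => χ w * f.1 w, hχ.mul f.2.1, fun w hw => by simp [f.2.2 w hw]⟩
  map_add' f g := by ext w; simp [mul_add]
  map_smul' c f := by ext w; simp [mul_left_comm]

open Classical in
/-- The operator `½ (∂/∂x_i + ε ∂/∂y_i)` on `C^∞(U)`, where `z_i = x_i + √-1 y_i`. -/
def wirtinger (ε : ℂ) (i : σ) : Smooth U →ₗ[ℂ] Smooth U where
  toFun f := ⟨fun w => if w ∈ U then
      1 / 2 * (fderiv ℝ f.1 w (Pi.single i 1) + ε * fderiv ℝ f.1 w (Pi.single i Complex.I))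
      else 0, by
    constructor
    · have h : ContDiffOn ℝ ∞ (fun w => fderiv ℝ f.1 w) U :=
        f.2.1.fderiv_of_isOpen U.isOpen (by simp)
      have h1 (v : σ → ℂ) : ContDiffOn ℝ ∞ (fun w => fderiv ℝ f.1 w v) U :=
        h.clm_apply contDiffOn_const
      have h2 : ContDiffOn ℝ ∞ (fun w => 1 / 2 * (fderiv ℝ f.1 w (Pi.single i 1) +
          ε * fderiv ℝ f.1 w (Pi.single i Complex.I))) U :=
        contDiffOn_const.mul
          ((h1 (Pi.single i 1)).add (contDiffOn_const.mul (h1 (Pi.single i Complex.I))))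
      exact h2.congr fun w hw => if_pos hw
    · intro w hw
      exact if_neg hw⟩
  map_add' f g := by
    ext w
    by_cases hw : w ∈ U
    · have := fderiv_add (smooth_differentiableAt f hw) (smooth_differentiableAt g hw)
      simp only [Submodule.coe_add, if_pos hw, Pi.add_apply, this, _root_.add_apply]
      ring
    · simp [hw]
  map_smul' c f := by
    ext w
    by_cases hw : w ∈ U
    · have := fderiv_const_smul (smooth_differentiableAt f hw) c
      simp only [Submodule.coe_smul, if_pos hw, Pi.smul_apply, this,
        _root_.smul_apply, smul_eq_mul, RingHom.id_apply]
      ring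
    · simp [hw]

/-- `∂/∂z_i` -/
def dz (i : σ) : Smooth U →ₗ[ℂ] Smooth U := wirtinger (-Complex.I) i

/-- `∂/∂z̄_i` -/
def dzbar (i : σ) : Smooth U →ₗ[ℂ] Smooth U := wirtinger Complex.I i

end Local

/-! ### Logarithmic polyvector fields on one coordinate subspace -/

/-- The exterior algebra on the symbols `dz̄_i` (`i ∈ σ`) and `θ̃_1, …, θ̃_n`. -/
abbrev Ext (n : ℕ) (σ : Finset (Fin d)) : Type := ExteriorAlgebra ℂ ((σ → ℂ) × (Fin n → ℂ))

/-- Left multiplication by `dz̄_i`. -/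
def wedgeBar (σ : Finset (Fin d)) (i : σ) : Ext n σ →ₗ[ℂ] Ext n σ :=
  LinearMap.mulLeft ℂ (ExteriorAlgebra.ι ℂ ((Pi.single i 1, 0) : (σ → ℂ) × (Fin n → ℂ)))

/-- Left multiplication by `θ̃_k`. -/
def wedgeTheta (σ : Finset (Fin d)) (k : Fin n) : Ext n σ →ₗ[ℂ] Ext n σ :=
  LinearMap.mulLeft ℂ (ExteriorAlgebra.ι ℂ ((0, Pi.single k 1) : (σ → ℂ) × (Fin n → ℂ)))

/-- The odd derivation `∂/∂θ̃_k`: contraction with the functional that is `1` on `θ̃_k` and `0` on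
the other generators. -/
def contrTheta (σ : Finset (Fin d)) (k : Fin n) : Ext n σ →ₗ[ℂ] Ext n σ :=
  CliffordAlgebra.contractLeft (Q := (0 : QuadraticForm ℂ ((σ → ℂ) × (Fin n → ℂ))))
    (LinearMap.proj k ∘ₗ LinearMap.snd ℂ (σ → ℂ) (Fin n → ℂ))

/-- Smooth sections of `⨁_{i,j} 𝒜^{0,j} ⊗ Θ^i` over `ℂ^σ ∩ Ω`, where `Θ^i` is the `i`-th exterior
power of the module with global frame `θ̃_k = ∑_l ⟨ρ_l, e^k⟩ z_l ∂/∂z_l`, `k = 1, …, n`. -/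
abbrev LocPV (n : ℕ) (Ω : TopologicalSpace.Opens (Fin d → ℂ)) (σ : Finset (Fin d)) : Type :=
  Smooth (dom Ω σ) ⊗[ℂ] Ext n σ

instance (Ω : TopologicalSpace.Opens (Fin d → ℂ)) (σ : Finset (Fin d)) :
    AddCommGroup (LocPV n Ω σ) := TensorProduct.addCommGroup

/-- The value of a polyvector field at a point. -/
def evalAt {Ω : TopologicalSpace.Opens (Fin d → ℂ)} {σ : Finset (Fin d)} (w : σ → ℂ) :
    LocPV n Ω σ →ₗ[ℂ] Ext n σ :=
  TensorProduct.lift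
    (LinearMap.lsmul ℂ (Ext n σ) ∘ₗ LinearMap.proj w ∘ₗ (Smooth (dom Ω σ)).subtype)

/-- The restriction of a smooth function from `ℂ^σ` to `ℂ^η`, for `η ⊆ σ`. -/
def resFun {Ω : TopologicalSpace.Opens (Fin d → ℂ)} {η σ : Finset (Fin d)} (h : η ⊆ σ) :
    Smooth (dom Ω σ) →ₗ[ℂ] Smooth (dom Ω η) where
  toFun f := ⟨fun w => f.1 (proj σ (ext η w)), by
    have key : ∀ w, ext σ (proj σ (ext η w)) = ext η w := by
      intro w
      funext i
      by_cases hi : i ∈ σ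
      · simp [ext, proj, hi]
      · have : i ∉ η := fun hh => hi (h hh)
        simp [ext, hi, this]
    have mem : ∀ w, proj σ (ext η w) ∈ dom Ω σ ↔ w ∈ dom Ω η := by
      intro w
      change ext σ (proj σ (ext η w)) ∈ Ω ↔ ext η w ∈ Ω
      rw [key]
    refine ⟨?_, fun w hw => f.2.2 _ (fun hh => hw ((mem w).1 hh))⟩
    exact f.2.1.comp (((proj σ).comp (ext η)).contDiff.contDiffOn) (fun w hw => (mem w).2 hw)⟩
  map_add' f g := rfl
  map_smul' c f := rfl

/-- The pull-back of generators: `dz̄_i ↦ dz̄_i` for `i ∈ η`, `dz̄_i ↦ 0` for `i ∈ σ ∖ η`, and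
`θ̃_k ↦ θ̃_k`. -/
def resExt {η σ : Finset (Fin d)} (h : η ⊆ σ) : Ext n σ →ₐ[ℂ] Ext n η :=
  ExteriorAlgebra.map
    ((LinearMap.funLeft ℂ ℂ (Set.inclusion h : η → σ)).prodMap LinearMap.id)

/-- The restriction of polyvector fields from `ℂ^σ` to `ℂ^η`, for `η ⊆ σ`. -/
def pull {Ω : TopologicalSpace.Opens (Fin d → ℂ)} {η σ : Finset (Fin d)} (h : η ⊆ σ) :
    LocPV n Ω σ →ₗ[ℂ] LocPV n Ω η :=
  TensorProduct.map (resFun h) (resExt h).toLinearMap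


open Classical in
/-- Restriction of smooth functions to a smaller open set. -/
def restrictFun {Ω Ω' : TopologicalSpace.Opens (Fin d → ℂ)} (h : Ω' ≤ Ω) (σ : Finset (Fin d)) :
    Smooth (dom Ω σ) →ₗ[ℂ] Smooth (dom Ω' σ) where
  toFun f := ⟨fun w => if w ∈ dom Ω' σ then f.1 w else 0,
    (f.2.1.mono (fun w (hw : ext σ w ∈ Ω') => h hw)).congr (fun w hw => if_pos hw),
    fun w hw => if_neg hw⟩
  map_add' f g := by ext w; by_cases hw : w ∈ dom Ω' σ <;> simp [hw]
  map_smul' c f := by ext w; by_cases hw : w ∈ dom Ω' σ <;> simp [hw]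

/-! ### The local operators -/

section Operators

variable (F : ProjFan n d) (Ω : TopologicalSpace.Opens (Fin d → ℂ))

/-- The linear form `g_k = θ̃_k(f) = ∑_i ⟨ρ_i, e^k⟩ z_i` on `ℂ^σ`, where `f = z_1 + ⋯ + z_d`. -/
def g (σ : Finset (Fin d)) (k : Fin n) (w : σ → ℂ) : ℂ := ∑ i : σ, (F.ray i k : ℂ) * w i

/-- `∑_k g_k ḡ_k` -/
def gNorm (σ : Finset (Fin d)) (w : σ → ℂ) : ℂ :=
  ∑ k, g F σ k w * (starRingEnd ℂ) (g F σ k w)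

lemma contDiff_coord (σ : Finset (Fin d)) (i : σ) (c : ℂ) :
    ContDiff ℝ ∞ (fun w : σ → ℂ => c * w i) :=
  contDiff_const.mul (contDiff_apply ℝ ℂ i)

lemma contDiff_g (σ : Finset (Fin d)) (k : Fin n) : ContDiff ℝ ∞ (g F σ k) :=
  ContDiff.sum fun i _ => contDiff_coord σ i _

lemma contDiff_conj_g (σ : Finset (Fin d)) (k : Fin n) :
    ContDiff ℝ ∞ (fun w => (starRingEnd ℂ) (g F σ k w)) :=
  Complex.conjCLE.contDiff.comp (contDiff_g F σ k)

/-- The logarithmic derivation `θ̃_k = ∑_i ⟨ρ_i, e^k⟩ z_i ∂/∂z_i` acting on functions on `ℂ^σ`. -/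
def logDeriv (σ : Finset (Fin d)) (k : Fin n) : Smooth (dom Ω σ) →ₗ[ℂ] Smooth (dom Ω σ) :=
  ∑ i : σ, mulFun (fun w => (F.ray i k : ℂ) * w i) (contDiff_coord σ i _).contDiffOn ∘ₗ dz i

/-- `∂̄ = ∑_i dz̄_i ∧ ∂/∂z̄_i` -/
def locDbar (σ : Finset (Fin d)) : LocPV n Ω σ →ₗ[ℂ] LocPV n Ω σ :=
  ∑ i : σ, TensorProduct.map (dzbar i) (wedgeBar σ i)

/-- `{f, -} = ∑_k g_k ∂/∂θ̃_k` -/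
def locBracket (σ : Finset (Fin d)) : LocPV n Ω σ →ₗ[ℂ] LocPV n Ω σ :=
  ∑ k, TensorProduct.map (mulFun (g F σ k) (contDiff_g F σ k).contDiffOn) (contrTheta σ k)

/-- `∂ = ∑_k θ̃_k ∂/∂θ̃_k`: the holomorphic de Rham differential on logarithmic forms, transported
to polyvector fields by contraction with `Ω = dz_1/z_1 ∧ ⋯ ∧ dz_n/z_n`. -/
def locDel (σ : Finset (Fin d)) : LocPV n Ω σ →ₗ[ℂ] LocPV n Ω σ :=
  ∑ k, TensorProduct.map (logDeriv F Ω σ k) (contrTheta σ k)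

/-- Multiplication by a smooth real-valued function on `ℂᵈ`. -/
def locMul (r : (Fin d → ℂ) → ℝ) (hr : ContDiff ℝ ∞ r) (σ : Finset (Fin d)) :
    LocPV n Ω σ →ₗ[ℂ] LocPV n Ω σ :=
  TensorProduct.map (mulFun (fun w => ((r (ext σ w) : ℝ) : ℂ))
    (Complex.ofRealCLM.contDiff.comp (hr.comp (ext σ).contDiff)).contDiffOn) LinearMap.id

/-- `ℂᵈ ∖ {0}` -/
def punctured (d : ℕ) : TopologicalSpace.Opens (Fin d → ℂ) := ⟨{0}ᶜ, isOpen_compl_singleton⟩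

lemma gNorm_ne_zero {σ : Finset (Fin d)} (hσ : σ ∈ F.cones) {w : σ → ℂ}
    (hw : w ∈ dom (punctured d) σ) : gNorm F σ w ≠ 0 := by
  intro h0
  have hk : ∀ k, g F σ k w = 0 := by
    have h1 : gNorm F σ w = ((∑ k, Complex.normSq (g F σ k w) : ℝ) : ℂ) := by
      simp [gNorm, Complex.mul_conj]
    rw [h1, Complex.ofReal_eq_zero,
      Finset.sum_eq_zero_iff_of_nonneg (fun _ _ => Complex.normSq_nonneg _)] at h0
    intro k
    exact Complex.normSq_eq_zero.1 (h0 k (Finset.mem_univ k))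
  obtain ⟨b, e, hb⟩ := F.smooth σ hσ
  have hw0 : w = 0 := by
    funext j
    have hpair : ∀ i : σ, ∑ k, b.coord (e j) (Pi.single k 1) * F.ray i k =
        if i = j then 1 else 0 := by
      intro i
      have h2 : b.coord (e j) (F.ray i) = if i = j then 1 else 0 := by
        rw [← hb i]
        by_cases hij : i = j
        · simp [hij]
        · have : e i ≠ e j := fun h => hij (e.injective h)
          simp [hij, this]
      rw [← h2]
      conv_rhs => rw [pi_eq_sum_univ' (F.ray i)]
      rw [map_sum]
      refine Finset.sum_congr rfl fun k _ => ?_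
      rw [map_smul, smul_eq_mul, mul_comm]
    have hpairC : ∀ i : σ, ∑ k, ((b.coord (e j) (Pi.single k 1) : ℤ) : ℂ) * (F.ray i k : ℂ) =
        if i = j then 1 else 0 := by
      intro i
      have := congrArg (fun z : ℤ => (z : ℂ)) (hpair i)
      push_cast at this
      exact this
    have h3 : ∑ k, ((b.coord (e j) (Pi.single k 1) : ℤ) : ℂ) * g F σ k w = w j := by
      simp only [g, Finset.mul_sum]
      rw [Finset.sum_comm]
      simp only [← mul_assoc, ← Finset.sum_mul, hpairC]
      simp
    rw [← h3]
    simp [hk]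
  apply hw
  rw [hw0]
  exact map_zero (ext σ)

lemma contDiffOn_vf {σ : Finset (Fin d)} (hσ : σ ∈ F.cones) (k : Fin n) :
    ContDiffOn ℝ ∞ (fun w => (starRingEnd ℂ) (g F σ k w) / gNorm F σ w)
      (dom (punctured d) σ) := by
  have h : ContDiff ℝ ∞ (gNorm F σ) :=
    ContDiff.sum fun k _ => (contDiff_g F σ k).mul (contDiff_conj_g F σ k)
  simp only [div_eq_mul_inv]
  exact (contDiff_conj_g F σ k).contDiffOn.mul
    (h.contDiffOn.inv fun w hw => gNorm_ne_zero F hσ hw)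

/-- Multiplication by `V_f = (∑_k g_k ḡ_k)⁻¹ ∑_k ḡ_k θ̃_k` on `ℂ^σ ∖ {0}`. -/
def locVf (σ : Finset (Fin d)) (hσ : σ ∈ F.cones) :
    LocPV n (punctured d) σ →ₗ[ℂ] LocPV n (punctured d) σ :=
  ∑ k, TensorProduct.map
    (mulFun (fun w => (starRingEnd ℂ) (g F σ k w) / gNorm F σ w) (contDiffOn_vf F hσ k))
    (wedgeTheta σ k)

/-! ### Compatibility of the local operators with restriction -/

section Compat

variable {η σ : Finset (Fin d)}

lemma proj_ext_single (h : η ⊆ σ) (i : η) (c : ℂ) :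
    proj σ (ext η (Pi.single i c)) = Pi.single (⟨i, h i.2⟩ : σ) c := by
  funext j
  by_cases hj : (j : Fin d) ∈ η
  · by_cases hij : j = ⟨i, h i.2⟩
    · subst hij; simp [proj, ext]
    · have : (⟨j, hj⟩ : η) ≠ i := fun hh => hij (by ext; simp [← hh])
      simp [proj, ext, hj, hij, this]
  · have : j ≠ ⟨i, h i.2⟩ := fun hh => hj (by rw [hh]; exact i.2)
    simp [proj, ext, hj, this]

lemma proj_ext_mem_iff (h : η ⊆ σ) (w : η → ℂ) : proj σ (ext η w) ∈ dom Ω σ ↔ w ∈ dom Ω η := by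
  change ext σ (proj σ (ext η w)) ∈ Ω ↔ ext η w ∈ Ω
  have : ext σ (proj σ (ext η w)) = ext η w := by
    funext i
    by_cases hi : i ∈ σ
    · simp [ext, proj, hi]
    · have : i ∉ η := fun hh => hi (h hh)
      simp [ext, hi, this]
  rw [this]

lemma ext_proj_ext (h : η ⊆ σ) (w : η → ℂ) : ext σ (proj σ (ext η w)) = ext η w := by
  funext i
  by_cases hi : i ∈ σ
  · simp [ext, proj, hi]
  · have : i ∉ η := fun hh => hi (h hh)
    simp [ext, hi, this]

lemma resFun_wirtinger (h : η ⊆ σ) (ε : ℂ) (i : η) (f : Smooth (dom Ω σ)) :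
    resFun h (wirtinger ε (⟨i, h i.2⟩ : σ) f) = wirtinger ε i (resFun h f) := by
  ext w
  by_cases hw : w ∈ dom Ω η
  · have hw' := (proj_ext_mem_iff Ω h w).2 hw
    have hd : HasFDerivAt (resFun h f).1
        ((fderiv ℝ f.1 (proj σ (ext η w))).comp ((proj σ).comp (ext η))) w :=
      HasFDerivAt.comp w (smooth_differentiableAt f hw').hasFDerivAt
        ((proj σ).comp (ext η)).hasFDerivAt
    simp only [resFun, wirtinger, LinearMap.coe_mk, AddHom.coe_mk, if_pos hw', if_pos hw]
    have hd' := hd.fderiv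
    simp only [resFun, LinearMap.coe_mk, AddHom.coe_mk] at hd'
    rw [hd']
    simp only [ContinuousLinearMap.comp_apply, proj_ext_single h]
  · have hw' : proj σ (ext η w) ∉ dom Ω σ := fun hh => hw ((proj_ext_mem_iff Ω h w).1 hh)
    simp [resFun, wirtinger, hw, hw']

lemma resFun_mulFun (h : η ⊆ σ) {χ : (σ → ℂ) → ℂ} {χ' : (η → ℂ) → ℂ} (hχ : ContDiffOn ℝ ∞ χ (dom Ω σ))
    (hχ' : ContDiffOn ℝ ∞ χ' (dom Ω η)) (hc : ∀ w, χ (proj σ (ext η w)) = χ' w)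
    (f : Smooth (dom Ω σ)) :
    resFun h (mulFun χ hχ f) = mulFun χ' hχ' (resFun h f) := by
  ext w
  simp [resFun, mulFun, hc]

lemma proj_ext_of_not_mem (w : η → ℂ) (i : σ) (hi : (i : Fin d) ∉ η) :
    proj σ (ext η w) i = 0 := by
  simp [proj, ext, hi]

lemma proj_ext_of_mem (h : η ⊆ σ) (w : η → ℂ) (i : η) : proj σ (ext η w) ⟨i, h i.2⟩ = w i := by
  simp [proj, ext]

lemma sum_incl (h : η ⊆ σ) {A : Type*} [AddCommMonoid A] (p : σ → A) (q : η → A)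
    (h0 : ∀ i : σ, (i : Fin d) ∉ η → p i = 0) (h1 : ∀ i : η, p ⟨i, h i.2⟩ = q i) :
    ∑ i, p i = ∑ i, q i := by
  symm
  refine Fintype.sum_of_injective (fun i : η => (⟨i, h i.2⟩ : σ)) ?_ q p ?_ ?_
  · intro a b hab
    exact Subtype.ext (congrArg (fun x : σ => (x : Fin d)) hab)
  · intro i hi
    exact h0 i fun hm => hi ⟨⟨i, hm⟩, rfl⟩
  · intro i
    exact (h1 i).symm

lemma g_res (h : η ⊆ σ) (k : Fin n) (w : η → ℂ) : g F σ k (proj σ (ext η w)) = g F η k w := by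
  refine sum_incl h _ _ (fun i hi => ?_) (fun i => ?_)
  · simp only [proj_ext_of_not_mem w i hi, mul_zero]
  · simp only [proj_ext_of_mem h w i]

lemma gNorm_res (h : η ⊆ σ) (w : η → ℂ) : gNorm F σ (proj σ (ext η w)) = gNorm F η w := by
  simp only [gNorm, g_res F h]

lemma resFun_logDeriv (h : η ⊆ σ) (k : Fin n) (f : Smooth (dom Ω σ)) :
    resFun h (logDeriv F Ω σ k f) = logDeriv F Ω η k (resFun h f) := by
  simp only [logDeriv, LinearMap.sum_apply, map_sum, LinearMap.comp_apply]
  refine sum_incl h _ _ (fun i hi => ?_) (fun i => ?_)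
  · ext w
    simp [resFun, mulFun, proj_ext_of_not_mem w i hi]
  · rw [show dz i (resFun h f) = resFun h (dz ⟨i, h i.2⟩ f) from
      (resFun_wirtinger Ω h _ i f).symm]
    refine resFun_mulFun Ω h _ _ (fun w => ?_) _
    simp only [proj_ext_of_mem h w i]

lemma resExt_wedgeTheta (h : η ⊆ σ) (k : Fin n) (x : Ext n σ) :
    resExt h (wedgeTheta σ k x) = wedgeTheta η k (resExt h x) := by
  simp only [wedgeTheta, LinearMap.mulLeft_apply, map_mul, resExt, ExteriorAlgebra.map_apply_ι]
  simp

lemma resExt_wedgeBar (h : η ⊆ σ) (i : η) (x : Ext n σ) :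
    resExt h (wedgeBar σ ⟨i, h i.2⟩ x) = wedgeBar η i (resExt h x) := by
  simp only [wedgeBar, LinearMap.mulLeft_apply, map_mul, resExt, ExteriorAlgebra.map_apply_ι]
  congr 3
  refine Prod.ext ?_ (by simp)
  funext j
  by_cases hij : j = i
  · subst hij; simp [LinearMap.funLeft, Set.inclusion]
  · have : Set.inclusion h j ≠ ⟨i, h i.2⟩ := fun hh =>
      hij (Subtype.ext (congrArg (fun x : σ => (x : Fin d)) hh))
    simp [LinearMap.funLeft, hij, this]

lemma resExt_wedgeBar_of_not_mem (h : η ⊆ σ) (i : σ) (hi : (i : Fin d) ∉ η) (x : Ext n σ) :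
    resExt h (wedgeBar σ i x) = 0 := by
  simp only [wedgeBar, LinearMap.mulLeft_apply, map_mul, resExt, ExteriorAlgebra.map_apply_ι]
  have : ((LinearMap.funLeft ℂ ℂ (Set.inclusion h : η → σ)).prodMap LinearMap.id)
      ((Pi.single i 1, 0) : (σ → ℂ) × (Fin n → ℂ)) = 0 := by
    refine Prod.ext ?_ (by simp)
    funext j
    have : Set.inclusion h j ≠ i := fun hh => hi (by rw [← hh]; exact j.2)
    simp [LinearMap.funLeft, this]
  rw [this, map_zero, zero_mul]

lemma resExt_contrTheta (h : η ⊆ σ) (k : Fin n) (x : Ext n σ) :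
    resExt h (contrTheta σ k x) = contrTheta η k (resExt h x) := by
  induction x using CliffordAlgebra.left_induction with
  | algebraMap r =>
    rw [AlgHom.commutes]
    simp only [contrTheta]
    erw [CliffordAlgebra.contractLeft_algebraMap, CliffordAlgebra.contractLeft_algebraMap]
    exact map_zero _
  | add x y hx hy => simp only [map_add, hx, hy]
  | ι_mul x m hx =>
    have h1 : resExt h (CliffordAlgebra.ι _ m) = ExteriorAlgebra.ι ℂ
        (((LinearMap.funLeft ℂ ℂ (Set.inclusion h : η → σ)).prodMap LinearMap.id) m) :=
      ExteriorAlgebra.map_apply_ι _ _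
    simp only [contrTheta] at hx ⊢
    rw [CliffordAlgebra.contractLeft_ι_mul, map_sub, map_smul, map_mul, map_mul, hx, h1]
    erw [CliffordAlgebra.contractLeft_ι_mul]
    rfl

lemma pull_map (h : η ⊆ σ) {Ω' : TopologicalSpace.Opens (Fin d → ℂ)}
    (a : Smooth (dom Ω σ) →ₗ[ℂ] Smooth (dom Ω' σ)) (a' : Smooth (dom Ω η) →ₗ[ℂ] Smooth (dom Ω' η))
    (b : Ext n σ →ₗ[ℂ] Ext n σ) (b' : Ext n η →ₗ[ℂ] Ext n η)
    (ha : ∀ f, resFun h (a f) = a' (resFun h f)) (hb : ∀ x, resExt h (b x) = b' (resExt h x))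
    (y : LocPV n Ω σ) :
    pull h (TensorProduct.map a b y) = TensorProduct.map a' b' (pull h y) := by
  induction y using TensorProduct.induction_on with
  | zero => simp only [map_zero]
  | tmul f x => simp [pull, ha, hb]
  | add y z hy hz => simp only [map_add, hy, hz]

lemma pull_locDbar (h : η ⊆ σ) (y : LocPV n Ω σ) : pull h (locDbar Ω σ y) = locDbar Ω η (pull h y) := by
  simp only [locDbar, LinearMap.sum_apply, map_sum]
  refine sum_incl h _ _ (fun i hi => ?_) (fun i => ?_)
  · induction y using TensorProduct.induction_on with
    | zero => simp only [map_zero]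
    | tmul f x => simp [pull, resExt_wedgeBar_of_not_mem h i hi]
    | add y z hy hz => simp only [map_add, hy, hz, add_zero]
  · exact pull_map Ω h _ _ _ _ (resFun_wirtinger Ω h _ i) (resExt_wedgeBar h i) y

lemma pull_locBracket (h : η ⊆ σ) (y : LocPV n Ω σ) :
    pull h (locBracket F Ω σ y) = locBracket F Ω η (pull h y) := by
  simp only [locBracket, LinearMap.sum_apply, map_sum]
  exact Finset.sum_congr rfl fun k _ => pull_map Ω h _ _ _ _
    (resFun_mulFun Ω h _ _ (g_res F h k)) (resExt_contrTheta h k) y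

lemma pull_locDel (h : η ⊆ σ) (y : LocPV n Ω σ) : pull h (locDel F Ω σ y) = locDel F Ω η (pull h y) := by
  simp only [locDel, LinearMap.sum_apply, map_sum]
  exact Finset.sum_congr rfl fun k _ => pull_map Ω h _ _ _ _
    (resFun_logDeriv F Ω h k) (resExt_contrTheta h k) y

lemma pull_locMul (h : η ⊆ σ) (r : (Fin d → ℂ) → ℝ) (hr : ContDiff ℝ ∞ r) (y : LocPV n Ω σ) :
    pull h (locMul Ω r hr σ y) = locMul Ω r hr η (pull h y) :=
  pull_map Ω h _ _ _ _ (resFun_mulFun Ω h _ _ (fun w => by rw [ext_proj_ext h])) (fun _ => rfl) y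

lemma pull_locVf (h : η ⊆ σ) (hσ : σ ∈ F.cones) (hη : η ∈ F.cones) (y : LocPV n (punctured d) σ) :
    pull h (locVf F σ hσ y) = locVf F η hη (pull h y) := by
  simp only [locVf, LinearMap.sum_apply, map_sum]
  exact Finset.sum_congr rfl fun k _ => pull_map _ h _ _ _ _
    (resFun_mulFun _ h _ _ (fun w => by rw [g_res F h, gNorm_res F h]))
    (resExt_wedgeTheta h k) y

lemma pull_restrict (h : η ⊆ σ) {Ω Ω' : TopologicalSpace.Opens (Fin d → ℂ)} (hΩ : Ω' ≤ Ω) (y : LocPV n Ω σ) :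
    pull h (TensorProduct.map (restrictFun hΩ σ) LinearMap.id y) =
      TensorProduct.map (restrictFun hΩ η) LinearMap.id (pull h y) := by
  refine pull_map Ω h _ _ _ _ (fun f => ?_) (fun _ => rfl) y
  ext w
  have := proj_ext_mem_iff Ω' h w
  by_cases hw : w ∈ dom Ω' η
  · simp [resFun, restrictFun, hw, this.2 hw]
  · simp [resFun, restrictFun, hw, mt this.1 hw]

end Compat

/-! ### Logarithmic polyvector fields on the central fibre -/

/-- `PV_log(X ∩ Ω)`: families of smooth polyvector fields on the components `X_σ` that agree on all
the intersections `X_σ ∩ X_τ = ℂ^{σ ∩ τ}` of dimension `n - 1`. -/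
def PV : Submodule ℂ (∀ σ : F.MaxCone, LocPV n Ω σ.1) where
  carrier := {α | ∀ σ τ : F.MaxCone, (σ.1 ∩ τ.1).card + 1 = n →
    pull Finset.inter_subset_left (α σ) = pull Finset.inter_subset_right (α τ)}
  zero_mem' := fun σ τ _ => by simp only [Pi.zero_apply, map_zero]
  add_mem' := fun {α β} hα hβ σ τ hc => by
    simp only [Pi.add_apply, map_add, hα σ τ hc, hβ σ τ hc]
  smul_mem' := fun c α hα σ τ hc => by
    simp only [Pi.smul_apply, map_smul, hα σ τ hc]

/-- The operator on polyvector fields given by compatible local operators. -/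
def glue {F : ProjFan n d} {Ω Ω' : TopologicalSpace.Opens (Fin d → ℂ)}
    (L : ∀ σ ∈ F.cones, LocPV n Ω σ →ₗ[ℂ] LocPV n Ω' σ)
    (hL : ∀ (η σ : Finset (Fin d)) (hη : η ∈ F.cones) (hσ : σ ∈ F.cones) (h : η ⊆ σ)
      (y : LocPV n Ω σ), pull h (L σ hσ y) = L η hη (pull h y)) :
    PV F Ω →ₗ[ℂ] PV F Ω' where
  toFun α := ⟨fun σ => L σ.1 σ.2.1 (α.1 σ), fun σ τ hc => by
    have hm : σ.1 ∩ τ.1 ∈ F.cones := F.mem_of_subset _ σ.2.1 _ Finset.inter_subset_left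
    rw [hL _ _ hm, hL _ _ hm, α.2 σ τ hc]⟩
  map_add' α β := by ext σ; simp
  map_smul' c α := by ext σ; simp

/-- `∂̄` on `PV_log(X ∩ Ω)` -/
def dbar : Module.End ℂ (PV F Ω) :=
  glue (fun σ _ => locDbar Ω σ) (fun _ _ _ _ h y => pull_locDbar Ω h y)

/-- `{f, -}` on `PV_log(X ∩ Ω)`, for the superpotential `f = z_1 + ⋯ + z_d` -/
def bracketF : Module.End ℂ (PV F Ω) :=
  glue (fun σ _ => locBracket F Ω σ) (fun _ _ _ _ h y => pull_locBracket F Ω h y)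

/-- `∂` on `PV_log(X ∩ Ω)` -/
def del : Module.End ℂ (PV F Ω) :=
  glue (fun σ _ => locDel F Ω σ) (fun _ _ _ _ h y => pull_locDel F Ω h y)

/-- Multiplication by a smooth function on `PV_log(X ∩ Ω)` -/
def mulBy (r : (Fin d → ℂ) → ℝ) (hr : ContDiff ℝ ∞ r) : Module.End ℂ (PV F Ω) :=
  glue (fun σ _ => locMul Ω r hr σ) (fun _ _ _ _ h y => pull_locMul Ω h r hr y)

/-- Multiplication by `V_f` on `PV_log(X ∖ {0})` -/
def Vf : Module.End ℂ (PV F (punctured d)) :=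
  glue (fun σ hσ => locVf F σ hσ) (fun _ _ hη hσ h y => pull_locVf F h hσ hη y)

/-- The restriction `PV_log(X) → PV_log(X ∖ {0})` -/
def toPunctured : PV F ⊤ →ₗ[ℂ] PV F (punctured d) :=
  glue (fun σ _ => TensorProduct.map (restrictFun le_top σ) LinearMap.id)
    (fun _ _ _ _ h y => pull_restrict h le_top y)

/-- The values at the origin (on all components) of a polyvector field on `X` -/
def atOrigin : PV F ⊤ →ₗ[ℂ] (∀ σ : F.MaxCone, Ext n σ.1) :=
  LinearMap.pi fun σ => evalAt 0 ∘ₗ LinearMap.proj σ ∘ₗ (PV F ⊤).subtype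

/-- `PV_{log,c}(X)`: the polyvector fields on `X` with compact support -/
def PVc : Submodule ℂ (PV F ⊤) where
  carrier := {α | ∀ σ : F.MaxCone, ∃ K : Set (σ.1 → ℂ), IsCompact K ∧ ∀ w ∉ K,
    evalAt w (α.1 σ) = 0}
  zero_mem' := fun σ => ⟨∅, isCompact_empty, fun w _ => by simp⟩
  add_mem' := fun {α β} hα hβ σ => by
    obtain ⟨K, hK, h⟩ := hα σ
    obtain ⟨K', hK', h'⟩ := hβ σ
    refine ⟨K ∪ K', hK.union hK', fun w hw => ?_⟩
    simp [h w (fun hh => hw (Or.inl hh)), h' w (fun hh => hw (Or.inr hh))]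
  smul_mem' := fun c α hα σ => by
    obtain ⟨K, hK, h⟩ := hα σ
    exact ⟨K, hK, fun w hw => by simp [h w hw]⟩

end Operators

/-! ### Formal power series in `u` -/

section Series

variable {V W : Type*} [AddCommGroup V] [Module ℂ V] [AddCommGroup W] [Module ℂ W]

/-- `V[[u]]`; a series `∑_m α_m u^m` is recorded by the sequence of its coefficients `α_m`. -/
abbrev Series (V : Type*) : Type _ := ℕ → V

/-- The `u`-linear extension of a linear map, applied coefficientwise. -/
def coeffwise (L : V →ₗ[ℂ] W) : Series V →ₗ[ℂ] Series W := L.compLeft ℕ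

/-- Multiplication by `u`. -/
def mulU : Module.End ℂ (Series V) where
  toFun a m := match m with
    | 0 => 0
    | m + 1 => a m
  map_add' a b := by funext m; cases m <;> simp
  map_smul' c a := by funext m; cases m <;> simp

/-- `C[[u]] ⊆ V[[u]]` for a subspace `C ⊆ V`. -/
def seriesIn (C : Submodule ℂ V) : Submodule ℂ (Series V) := Submodule.pi Set.univ fun _ => C

end Series

section Differentials

variable (F : ProjFan n d) (Ω : TopologicalSpace.Opens (Fin d → ℂ))

/-- `∂̄_f = ∂̄ + {f, -}` -/
def dbarF : Module.End ℂ (PV F Ω) := dbar F Ω + bracketF F Ω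

/-- `Q = ∂̄ + u∂` on `PV_log(X ∩ Ω)[[u]]` -/
def Q : Module.End ℂ (Series (PV F Ω)) := coeffwise (dbar F Ω) + mulU * coeffwise (del F Ω)

/-- `Q_f = ∂̄_f + u∂` on `PV_log(X ∩ Ω)[[u]]` -/
def Qf : Module.End ℂ (Series (PV F Ω)) := coeffwise (dbarF F Ω) + mulU * coeffwise (del F Ω)

end Differentials

/-! ### The homotopy -/

section Homotopy

variable {W : Type*} [AddCommGroup W] [Module ℂ W]

/-- `ρ + (Dρ) V (1 + [D, V])⁻¹`, where `(Dρ) = [D, ρ] = Dρ - ρD`. -/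
def formulaT (D v ρ : Module.End ℂ W) : Module.End ℂ W :=
  ρ + (D * ρ - ρ * D) * v * Ring.inverse (1 + oddComm D v)

/-- `(1 - ρ) V (1 + [D, V])⁻¹` -/
def formulaR (D v ρ : Module.End ℂ W) : Module.End ℂ W :=
  (1 - ρ) * v * Ring.inverse (1 + oddComm D v)

end Homotopy

end

end LogLG

namespace LogLG

noncomputable section

/-! ### Differential operators on smooth functions -/

section Functions

variable {n d : ℕ} {σ : Finset (Fin d)} {U : TopologicalSpace.Opens (σ → ℂ)}

/-! Write D for `∂̄` or `Q`, and D_f = D + {f,-}. The rays of a cone are part of a lattice basis, so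
the linear forms g_k have no common zero on X_σ away from the origin. Hence V_f is smooth there, and
pairing it with {f,-} gives Σ g_k ḡ_k / Σ g_k ḡ_k = 1 (`locBracket_anticomm_locVf`). Therefore P =
[D_f, V_f] = 1 + [D, V_f].

The operator [∂̄, V_f] is multiplication by an even form, a finite sum of commuting square-zero
terms. It is nilpotent, and P is invertible for D = ∂̄ (`isNilpotent_locDbar_anticomm_locVf`). For D
= Q the additional term is divisible by u, so the equation Pa = c is solved coefficient by
coefficient (`isUnit_coeffwise_add_mulU`).

Since D_f² = 0, P commutes with D_f, so V_f P⁻¹ contracts the complex over X ∖ {0}. Cutting it off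
by 1 - ρ produces the error term -[D_f, ρ] V_f P⁻¹, and [D_f, ρ] = [D, ρ] because {f,-} is linear
over functions. This is the homotopy formula (`oddComm_formulaR`).

To pass to X, choose χ vanishing near 0 with χ(1 - ρ) = 1 - ρ. Multiplication by χ extends fields
over the origin by zero, and this defines R; T is then defined as 1 - [D_f, R], and its formula is
read off on X ∖ {0} (`exists_homotopy`). Locality of the operators bounds the support of T by that
of ρ. For R, locality of P⁻¹ is avoided: compactness of support passes from Pβ to β by nilpotency,
then by induction on the power of u. A homotopy with these support properties gives the
quasi-isomorphisms (`inclusionIsQuasiIso_of_homotopy`).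

All operators are sums of tensors (operator on functions) ⊗ (operator on the exterior algebra),
glued over the components, so the algebraic identities are checked on one X_σ at a time. -/

lemma smooth_ext {f f' : Smooth U} (h : ∀ w ∈ U, f.1 w = f'.1 w) : f = f' := by
  ext w
  by_cases hw : w ∈ U
  · exact h w hw
  · rw [f.2.2 w hw, f'.2.2 w hw]

lemma mulFun_apply (χ : (σ → ℂ) → ℂ) (hχ : ContDiffOn ℝ ∞ χ U) (f : Smooth U) (w : σ → ℂ) :
    (mulFun χ hχ f).1 w = χ w * f.1 w := rfl

lemma mulFun_congr {χ χ' : (σ → ℂ) → ℂ} (hχ : ContDiffOn ℝ ∞ χ U) (hχ' : ContDiffOn ℝ ∞ χ' U)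
    (h : ∀ w ∈ U, χ w = χ' w) : mulFun χ hχ = mulFun χ' hχ' := by
  refine LinearMap.ext fun f => smooth_ext fun w hw => ?_
  rw [mulFun_apply, mulFun_apply, h w hw]

lemma mulFun_mul {χ χ' : (σ → ℂ) → ℂ} (hχ : ContDiffOn ℝ ∞ χ U) (hχ' : ContDiffOn ℝ ∞ χ' U) :
    (mulFun χ hχ * mulFun χ' hχ' : Module.End ℂ (Smooth U)) =
      mulFun (fun w => χ w * χ' w) (hχ.mul hχ') := by
  ext f w
  simp [mulFun_apply, mul_assoc]

lemma mulFun_commute {χ χ' : (σ → ℂ) → ℂ} (hχ : ContDiffOn ℝ ∞ χ U) (hχ' : ContDiffOn ℝ ∞ χ' U) :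
    Commute (mulFun χ hχ : Module.End ℂ (Smooth U)) (mulFun χ' hχ') := by
  rw [commute_iff_eq, mulFun_mul, mulFun_mul]
  exact mulFun_congr _ _ fun w _ => mul_comm _ _

open Classical in
/-- The derivative in a real direction `v`. -/
def dirDeriv (v : σ → ℂ) : Smooth U →ₗ[ℂ] Smooth U where
  toFun f := ⟨fun w => if w ∈ U then fderiv ℝ f.1 w v else 0,
    ((f.2.1.fderiv_of_isOpen U.isOpen (by simp)).clm_apply contDiffOn_const).congr
      fun w hw => if_pos hw, fun w hw => if_neg hw⟩
  map_add' f g := by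
    refine smooth_ext fun w hw => ?_
    have := fderiv_add (smooth_differentiableAt f hw) (smooth_differentiableAt g hw)
    simp [if_pos hw, this]
  map_smul' c f := by
    refine smooth_ext fun w hw => ?_
    have := fderiv_const_smul (smooth_differentiableAt f hw) c
    simp [if_pos hw, this]

lemma dirDeriv_apply (v : σ → ℂ) (f : Smooth U) {w : σ → ℂ} (hw : w ∈ U) :
    (dirDeriv v f).1 w = fderiv ℝ f.1 w v := if_pos hw

/-- Symmetry of the second derivative, valid since a point of the open set U has a neighbourhood on
which the function is smooth. -/
lemma dirDeriv_commute (v v' : σ → ℂ) :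
    Commute (dirDeriv v : Module.End ℂ (Smooth U)) (dirDeriv v') := by
  have key : ∀ (v v' : σ → ℂ) (f : Smooth U), ∀ w ∈ U,
      (dirDeriv v (dirDeriv v' f)).1 w = fderiv ℝ (fderiv ℝ f.1) w v v' := by
    intro v v' f w hw
    rw [dirDeriv_apply v _ hw]
    have h1 : (dirDeriv v' f).1 =ᶠ[nhds w] fun w => fderiv ℝ f.1 w v' := by
      filter_upwards [U.isOpen.mem_nhds hw] with w' hw'
      exact dirDeriv_apply v' f hw'
    have h2 : DifferentiableAt ℝ (fderiv ℝ f.1) w :=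
      ((smooth_contDiffAt f hw).fderiv_right (m := 1) (by norm_cast)).differentiableAt (by simp)
    rw [h1.fderiv_eq, fderiv_clm_apply h2 (differentiableAt_const v')]
    simp
  refine LinearMap.ext fun f => smooth_ext fun w hw => ?_
  have hs : IsSymmSndFDerivAt ℝ f.1 w :=
    (smooth_contDiffAt f hw).isSymmSndFDerivAt (by simp; norm_cast)
  change (dirDeriv v (dirDeriv v' f)).1 w = (dirDeriv v' (dirDeriv v f)).1 w
  rw [key v v' f w hw, key v' v f w hw, hs]

lemma wirtinger_apply (ε : ℂ) (i : σ) (f : Smooth U) {w : σ → ℂ} (hw : w ∈ U) :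
    (wirtinger ε i f).1 w =
      1 / 2 * (fderiv ℝ f.1 w (Pi.single i 1) + ε * fderiv ℝ f.1 w (Pi.single i Complex.I)) :=
  if_pos hw

lemma wirtinger_eq (ε : ℂ) (i : σ) : (wirtinger ε i : Module.End ℂ (Smooth U)) =
    (1 / 2 : ℂ) • (dirDeriv (Pi.single i 1) + ε • dirDeriv (Pi.single i Complex.I)) := by
  refine LinearMap.ext fun f => smooth_ext fun w hw => ?_
  rw [wirtinger_apply ε i f hw]
  simp only [LinearMap.smul_apply, LinearMap.add_apply, Submodule.coe_smul, Submodule.coe_add,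
    Pi.smul_apply, Pi.add_apply, dirDeriv_apply _ f hw, smul_eq_mul]

lemma wirtinger_commute (ε ε' : ℂ) (i j : σ) :
    Commute (wirtinger ε i : Module.End ℂ (Smooth U)) (wirtinger ε' j) := by
  rw [wirtinger_eq, wirtinger_eq]
  refine (Commute.smul_left ?_ _).smul_right _
  refine Commute.add_left (Commute.add_right ?_ ?_) (Commute.add_right ?_ ?_)
  · exact dirDeriv_commute _ _
  · exact (dirDeriv_commute _ _).smul_right _
  · exact (dirDeriv_commute _ _).smul_left _
  · exact ((dirDeriv_commute _ _).smul_left _).smul_right _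

/-- The Wirtinger derivative of a function on `ℂ^σ`. -/
def wirtFun (ε : ℂ) (i : σ) (χ : (σ → ℂ) → ℂ) (w : σ → ℂ) : ℂ :=
  1 / 2 * (fderiv ℝ χ w (Pi.single i 1) + ε * fderiv ℝ χ w (Pi.single i Complex.I))

lemma contDiffOn_wirtFun (ε : ℂ) (i : σ) {χ : (σ → ℂ) → ℂ} (hχ : ContDiffOn ℝ ∞ χ U) :
    ContDiffOn ℝ ∞ (wirtFun ε i χ) U := by
  have h := hχ.fderiv_of_isOpen U.isOpen (m := ∞) (by simp)
  exact contDiffOn_const.mul ((h.clm_apply contDiffOn_const).add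
    (contDiffOn_const.mul (h.clm_apply contDiffOn_const)))

/-- The Leibniz rule as an identity of operators: the commutator of a derivation with a
multiplication is again a multiplication. This is what makes [∂̄, V_f] a multiplication operator. -/
lemma wirtinger_mul_mulFun (ε : ℂ) (i : σ) {χ : (σ → ℂ) → ℂ} (hχ : ContDiffOn ℝ ∞ χ U) :
    (wirtinger ε i * mulFun χ hχ : Module.End ℂ (Smooth U)) =
      mulFun χ hχ * wirtinger ε i + mulFun (wirtFun ε i χ) (contDiffOn_wirtFun ε i hχ) := by
  refine LinearMap.ext fun f => smooth_ext fun w hw => ?_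
  have h1 : DifferentiableAt ℝ χ w :=
    (hχ.contDiffAt (U.isOpen.mem_nhds hw)).differentiableAt (by simp)
  have h2 := fderiv_fun_mul h1 (smooth_differentiableAt f hw)
  change (wirtinger ε i (mulFun χ hχ f)).1 w =
    χ w * (wirtinger ε i f).1 w + wirtFun ε i χ w * f.1 w
  rw [wirtinger_apply ε i _ hw, wirtinger_apply ε i _ hw]
  change 1 / 2 * (fderiv ℝ (fun w => χ w * f.1 w) w (Pi.single i 1) +
    ε * fderiv ℝ (fun w => χ w * f.1 w) w (Pi.single i Complex.I)) = _
  rw [h2, wirtFun]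
  simp only [_root_.add_apply, _root_.smul_apply, smul_eq_mul]
  ring

/-- The factor 1 + ε√-1 vanishes for ∂/∂z̄ (ε = √-1) and equals 2 for ∂/∂z (ε = -√-1). -/
lemma wirtFun_coord (ε : ℂ) (i j : σ) (c : ℂ) (w : σ → ℂ) :
    wirtFun ε i (fun w => c * w j) w = if i = j then 1 / 2 * c * (1 + ε * Complex.I) else 0 := by
  have h : HasFDerivAt (fun w : σ → ℂ => c * w j)
      (c • (ContinuousLinearMap.proj j : (σ → ℂ) →L[ℝ] ℂ)) w :=
    ((ContinuousLinearMap.proj j : (σ → ℂ) →L[ℝ] ℂ).hasFDerivAt (x := w)).const_smul c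
  rw [wirtFun, h.fderiv]
  by_cases hij : i = j
  · subst hij
    simp
    ring
  · simp [hij]

/-- A linear operator between spaces of smooth functions that does not enlarge supports. -/
def LocalFun {U' : TopologicalSpace.Opens (σ → ℂ)} (A : Smooth U →ₗ[ℂ] Smooth U') : Prop :=
  ∀ (f : Smooth U) (W : Set (σ → ℂ)), IsOpen W → (∀ w ∈ W, f.1 w = 0) → ∀ w ∈ W, (A f).1 w = 0

lemma localFun_mulFun {χ : (σ → ℂ) → ℂ} (hχ : ContDiffOn ℝ ∞ χ U) :
    LocalFun (mulFun χ hχ) := fun f W _ hf w hw => by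
  rw [mulFun_apply, hf w hw, mul_zero]

lemma localFun_wirtinger (ε : ℂ) (i : σ) : LocalFun (wirtinger ε i : Smooth U →ₗ[ℂ] Smooth U) := by
  intro f W hW hf w hw
  by_cases hU : w ∈ U
  · have h : f.1 =ᶠ[nhds w] fun _ => 0 := by
      filter_upwards [hW.mem_nhds hw] with w' hw' using hf w' hw'
    rw [wirtinger_apply ε i f hU, h.fderiv_eq]
    simp
  · exact (wirtinger ε i f).2.2 w hU

lemma LocalFun.comp {U' U'' : TopologicalSpace.Opens (σ → ℂ)} {A : Smooth U →ₗ[ℂ] Smooth U'}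
    {B : Smooth U' →ₗ[ℂ] Smooth U''} (hB : LocalFun B) (hA : LocalFun A) : LocalFun (B ∘ₗ A) :=
  fun f W hW hf => hB _ W hW (hA f W hW hf)

lemma LocalFun.sum {ι : Type*} (s : Finset ι) {A : ι → Smooth U →ₗ[ℂ] Smooth U}
    (h : ∀ i, LocalFun (A i)) : LocalFun (∑ i ∈ s, A i) := by
  intro f W hW hf w hw
  simp only [LinearMap.sum_apply, Submodule.coe_sum, Finset.sum_apply]
  exact Finset.sum_eq_zero fun i _ => h i f W hW hf w hw

end Functions

/-! ### Logarithmic derivations and their commutation relations -/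

section LogDerivations

variable {n d : ℕ} (F : ProjFan n d) (Ω : TopologicalSpace.Opens (Fin d → ℂ))
  (σ : Finset (Fin d))

lemma localFun_logDeriv (k : Fin n) : LocalFun (logDeriv F Ω σ k) :=
  LocalFun.sum _ fun i => (localFun_mulFun _).comp (localFun_wirtinger _ i)

/-- Multiplication by the coordinate `z_i`. -/
def coordMul (i : σ) : Module.End ℂ (Smooth (dom Ω σ)) :=
  -- The factor 1 makes this the case c = 1 of `contDiff_coord` and `wirtFun_coord`.
  mulFun (fun w => 1 * w i) (contDiff_coord σ i 1).contDiffOn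

lemma mulFun_coord (i : σ) (c : ℂ) :
    mulFun (U := dom Ω σ) (fun w => c * w i) (contDiff_coord σ i c).contDiffOn =
      c • coordMul Ω σ i := by
  ext f w
  simp [coordMul, mulFun_apply, mul_assoc]

lemma mulFun_g (k : Fin n) : mulFun (U := dom Ω σ) (g F σ k) (contDiff_g F σ k).contDiffOn =
    ∑ i : σ, (F.ray i k : ℂ) • coordMul Ω σ i := by
  ext f w
  simp [coordMul, mulFun_apply, g, Finset.sum_mul, mul_assoc]

lemma wirtinger_mul_coordMul (ε : ℂ) (i j : σ) :
    (wirtinger ε i * coordMul Ω σ j : Module.End ℂ (Smooth (dom Ω σ))) =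
      coordMul Ω σ j * wirtinger ε i + (if i = j then 1 / 2 * (1 + ε * Complex.I) else 0 : ℂ) • 1 := by
  rw [coordMul, wirtinger_mul_mulFun]
  congr 1
  ext f w
  simp only [mulFun_apply, wirtFun_coord, mul_one]
  split_ifs <;> simp

lemma dzbar_mul_coordMul (i j : σ) :
    Commute (dzbar i : Module.End ℂ (Smooth (dom Ω σ))) (coordMul Ω σ j) := by
  rw [commute_iff_eq, dzbar, wirtinger_mul_coordMul]
  simp

lemma dz_mul_coordMul (i j : σ) :
    (dz i * coordMul Ω σ j : Module.End ℂ (Smooth (dom Ω σ))) =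
      coordMul Ω σ j * dz i + (if i = j then 1 else 0 : ℂ) • 1 := by
  rw [dz, wirtinger_mul_coordMul]
  congr 3
  simp
  norm_num

lemma coordMul_commute (i j : σ) : Commute (coordMul Ω σ i) (coordMul Ω σ j) :=
  mulFun_commute _ _

lemma logDeriv_eq (k : Fin n) : logDeriv F Ω σ k =
    ∑ i : σ, (F.ray i k : ℂ) • (coordMul Ω σ i * dz i) := by
  rw [logDeriv]
  refine Finset.sum_congr rfl fun i _ => ?_
  rw [mulFun_coord]
  rfl

lemma dzbar_commute_mulFun_g (i : σ) (k : Fin n) :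
    Commute (dzbar i : Module.End ℂ (Smooth (dom Ω σ)))
      (mulFun (g F σ k) (contDiff_g F σ k).contDiffOn) := by
  rw [mulFun_g]
  exact Commute.sum_right _ _ _ fun j _ => (dzbar_mul_coordMul Ω σ i j).smul_right _

lemma dzbar_commute_logDeriv (i : σ) (k : Fin n) :
    Commute (dzbar i : Module.End ℂ (Smooth (dom Ω σ))) (logDeriv F Ω σ k) := by
  rw [logDeriv_eq]
  exact Commute.sum_right _ _ _ fun j _ =>
    ((dzbar_mul_coordMul Ω σ i j).mul_right (wirtinger_commute _ _ i j)).smul_right _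

lemma dzbar_commute (i j : σ) :
    Commute (dzbar i : Module.End ℂ (Smooth (dom Ω σ))) (dzbar j) := wirtinger_commute _ _ i j

/-- Euler operators in distinct variables commute because all four factors do. -/
lemma coordMul_dz_commute (i j : σ) :
    Commute (coordMul Ω σ i * dz i) (coordMul Ω σ j * dz j) := by
  by_cases hij : i = j
  · rw [hij]
  · have h1 : Commute (dz i) (coordMul Ω σ j) := by
      rw [commute_iff_eq, dz_mul_coordMul, if_neg hij, zero_smul, add_zero]
    have h2 : Commute (coordMul Ω σ i) (dz j) := by
      rw [commute_iff_eq, dz_mul_coordMul, if_neg (Ne.symm hij), zero_smul, add_zero]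
    exact ((coordMul_commute Ω σ i j).mul_right h2).mul_left
      (h1.mul_right (wirtinger_commute _ _ i j))

lemma logDeriv_commute (k l : Fin n) : Commute (logDeriv F Ω σ k) (logDeriv F Ω σ l) := by
  rw [logDeriv_eq, logDeriv_eq]
  exact Commute.sum_left _ _ _ fun i _ => Commute.sum_right _ _ _ fun j _ =>
    ((coordMul_dz_commute Ω σ i j).smul_left _).smul_right _

/-- The commutator of `θ̃_l` and `g_k`; it is symmetric in `k` and `l`. -/
lemma logDeriv_mul_mulFun_g (k l : Fin n) :
    (logDeriv F Ω σ l * mulFun (g F σ k) (contDiff_g F σ k).contDiffOn :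
        Module.End ℂ (Smooth (dom Ω σ))) =
      mulFun (g F σ k) (contDiff_g F σ k).contDiffOn * logDeriv F Ω σ l +
        ∑ i : σ, ((F.ray i k : ℂ) * (F.ray i l : ℂ)) • coordMul Ω σ i := by
  -- The Euler operator z_i ∂/∂z_i fixes z_i and kills the other coordinates, so only the diagonal
  -- of the double sum contributes.
  have key : ∀ i j : σ, (coordMul Ω σ i * dz i) * coordMul Ω σ j =
      coordMul Ω σ j * (coordMul Ω σ i * dz i) +
        (if i = j then 1 else 0 : ℂ) • coordMul Ω σ i := by
    intro i j
    rw [mul_assoc, dz_mul_coordMul, mul_add, mul_smul_comm, mul_one, ← mul_assoc, ← mul_assoc,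
      (coordMul_commute Ω σ i j).eq]
  rw [mulFun_g, logDeriv_eq, Finset.sum_mul_sum, Finset.sum_mul_sum, Finset.sum_comm,
    ← Finset.sum_add_distrib]
  refine Finset.sum_congr rfl fun i _ => ?_
  simp only [smul_mul_smul_comm, key, smul_add, smul_smul, Finset.sum_add_distrib]
  simp [mul_comm]

end LogDerivations

/-! ### Sign rules for products of two odd elements -/

section Ring

variable {R : Type*} [Ring R] {a b c e : R}

/-- Moving one product of two odd elements past another takes four transpositions, an even number of
signs. -/
lemma commute_mul_mul_of_anticomm (hbc : b * c = -(c * b)) (hea : e * a = -(a * e))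
    (hca : c * a = -(a * c)) (heb : e * b = -(b * e)) : Commute (a * b) (c * e) := by
  rw [commute_iff_eq]
  calc a * b * (c * e) = a * (b * c) * e := by simp only [mul_assoc]
    _ = -(a * c) * (b * e) := by rw [hbc]; simp only [mul_assoc, neg_mul, mul_neg]
    _ = c * a * -(e * b) := by rw [hca, heb, neg_neg]
    _ = c * -(a * e) * b := by simp only [mul_assoc, neg_mul, mul_neg]
    _ = c * e * (a * b) := by rw [← hea]; simp only [mul_assoc]

lemma mul_mul_self_eq_zero_of_anticomm (hba : b * a = -(a * b)) (ha : a * a = 0) :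
    a * b * (a * b) = 0 := by
  calc a * b * (a * b) = a * (b * a) * b := by simp only [mul_assoc]
    _ = -(a * a) * (b * b) := by rw [hba]; simp only [mul_assoc, neg_mul, mul_neg]
    _ = 0 := by rw [ha, neg_zero, zero_mul]

end Ring

/-! ### Anticommutators of sums of tensor products of operators -/

section Tensor

variable {M N : Type*} [AddCommGroup M] [Module ℂ M] [AddCommGroup N] [Module ℂ N]

/-- The sign sits entirely in the exterior factor, so the anticommutator of the tensors becomes an
ordinary commutator of their function parts. -/
lemma map_sum_anticomm {ι κ : Type*} [Fintype ι] [Fintype κ] (A : ι → Module.End ℂ M)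
    (B : ι → Module.End ℂ N) (C : κ → Module.End ℂ M) (E : κ → Module.End ℂ N)
    (h : ∀ i k, E k * B i = -(B i * E k)) :
    oddComm (∑ i, TensorProduct.map (A i) (B i)) (∑ k, TensorProduct.map (C k) (E k)) =
      ∑ i, ∑ k, TensorProduct.map (A i * C k - C k * A i) (B i * E k) := by
  rw [oddComm, Finset.sum_mul_sum, Finset.sum_mul_sum,
    Finset.sum_comm (s := Finset.univ (α := κ)), ← Finset.sum_add_distrib]
  refine Finset.sum_congr rfl fun i _ => ?_
  rw [← Finset.sum_add_distrib]
  refine Finset.sum_congr rfl fun k _ => ?_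
  rw [← TensorProduct.map_mul, ← TensorProduct.map_mul, h]
  refine TensorProduct.ext' fun x y => ?_
  simp [TensorProduct.tmul_neg, TensorProduct.sub_tmul, ← sub_eq_add_neg]

lemma map_sum_anticomm_eq_zero {ι κ : Type*} [Fintype ι] [Fintype κ] (A : ι → Module.End ℂ M)
    (B : ι → Module.End ℂ N) (C : κ → Module.End ℂ M) (E : κ → Module.End ℂ N)
    (h : ∀ i k, E k * B i = -(B i * E k)) (hc : ∀ i k, Commute (A i) (C k)) :
    oddComm (∑ i, TensorProduct.map (A i) (B i)) (∑ k, TensorProduct.map (C k) (E k)) = 0 := by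
  rw [map_sum_anticomm A B C E h]
  refine Finset.sum_eq_zero fun i _ => Finset.sum_eq_zero fun k _ => ?_
  rw [(hc i k).eq, sub_self, TensorProduct.map_zero_left]

/-- [L, L] = 2L², and 2 is invertible. This lets squares be treated like the mixed anticommutators.
-/
lemma mul_self_eq_zero_of_oddComm {L : Module.End ℂ M} (h : oddComm L L = 0) : L * L = 0 := by
  have h2 : (2 : ℂ) • (L * L) = 0 := by rw [two_smul]; exact h
  exact (smul_eq_zero.1 h2).resolve_left two_ne_zero

end Tensor

/-! ### Anticommutation in the exterior algebra -/

section Exterior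

variable {n d : ℕ} {σ : Finset (Fin d)}

lemma mulLeft_ι_anticomm {V : Type*} [AddCommGroup V] [Module ℂ V] (x y : V) :
    (LinearMap.mulLeft ℂ (ExteriorAlgebra.ι ℂ x) * LinearMap.mulLeft ℂ (ExteriorAlgebra.ι ℂ y) :
      Module.End ℂ (ExteriorAlgebra ℂ V)) =
    -(LinearMap.mulLeft ℂ (ExteriorAlgebra.ι ℂ y) * LinearMap.mulLeft ℂ (ExteriorAlgebra.ι ℂ x)) := by
  refine LinearMap.ext fun z => ?_
  change ExteriorAlgebra.ι ℂ x * (ExteriorAlgebra.ι ℂ y * z) =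
    -(ExteriorAlgebra.ι ℂ y * (ExteriorAlgebra.ι ℂ x * z))
  rw [← mul_assoc, ← mul_assoc, eq_neg_of_add_eq_zero_left (ExteriorAlgebra.ι_add_mul_swap x y)]
  exact neg_mul _ _

lemma wedgeBar_anticomm (i j : σ) : (wedgeBar σ j * wedgeBar σ i : Module.End ℂ (Ext n σ)) =
    -(wedgeBar σ i * wedgeBar σ j) := mulLeft_ι_anticomm _ _

lemma wedgeTheta_wedgeBar (i : σ) (k : Fin n) :
    (wedgeTheta σ k * wedgeBar σ i : Module.End ℂ (Ext n σ)) =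
      -(wedgeBar σ i * wedgeTheta σ k) := mulLeft_ι_anticomm _ _

lemma wedgeTheta_anticomm (k l : Fin n) :
    (wedgeTheta σ l * wedgeTheta σ k : Module.End ℂ (Ext n σ)) =
      -(wedgeTheta σ k * wedgeTheta σ l) := mulLeft_ι_anticomm _ _

lemma wedgeBar_sq (i : σ) : (wedgeBar σ i * wedgeBar σ i : Module.End ℂ (Ext n σ)) = 0 := by
  refine LinearMap.ext fun x => ?_
  simp only [wedgeBar, Module.End.mul_apply, LinearMap.mulLeft_apply, ← mul_assoc,
    ExteriorAlgebra.ι_sq_zero, zero_mul, LinearMap.zero_apply]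

lemma contrTheta_anticomm (k l : Fin n) :
    (contrTheta σ l * contrTheta σ k : Module.End ℂ (Ext n σ)) =
      -(contrTheta σ k * contrTheta σ l) :=
  LinearMap.ext fun x => CliffordAlgebra.contractLeft_comm _ _ x

lemma contrTheta_wedgeBar (i : σ) (k : Fin n) :
    (contrTheta σ k * wedgeBar σ i : Module.End ℂ (Ext n σ)) =
      -(wedgeBar σ i * contrTheta σ k) := by
  refine LinearMap.ext fun x => ?_
  refine (CliffordAlgebra.contractLeft_ι_mul _ _ _).trans ?_
  simp only [LinearMap.comp_apply, LinearMap.snd_apply, map_zero, zero_smul, zero_sub]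
  rfl

/-- The canonical anticommutation relation; its δ_kl is the source of [{f,-}, V_f] = 1. -/
lemma contrTheta_wedgeTheta (k l : Fin n) :
    (contrTheta σ k * wedgeTheta σ l : Module.End ℂ (Ext n σ)) =
      (if k = l then 1 else 0 : ℂ) • 1 - wedgeTheta σ l * contrTheta σ k := by
  refine LinearMap.ext fun x => ?_
  refine (CliffordAlgebra.contractLeft_ι_mul _ _ _).trans ?_
  simp only [LinearMap.comp_apply, LinearMap.snd_apply, LinearMap.proj_apply, Pi.single_apply]
  rfl

end Exterior

/-! ### Identities between the local operators -/

section LocalIdentities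

variable {n d : ℕ} (F : ProjFan n d) (Ω : TopologicalSpace.Opens (Fin d → ℂ))
  (σ : Finset (Fin d))

lemma locDbar_anticomm_self : oddComm (locDbar Ω σ : Module.End ℂ (LocPV n Ω σ)) (locDbar Ω σ) = 0 :=
  map_sum_anticomm_eq_zero _ _ _ _ wedgeBar_anticomm (dzbar_commute Ω σ)

lemma locBracket_anticomm_self : oddComm (locBracket F Ω σ) (locBracket F Ω σ) = 0 :=
  map_sum_anticomm_eq_zero _ _ _ _ contrTheta_anticomm fun _ _ => mulFun_commute _ _

lemma locDel_anticomm_self : oddComm (locDel F Ω σ) (locDel F Ω σ) = 0 :=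
  map_sum_anticomm_eq_zero _ _ _ _ contrTheta_anticomm (logDeriv_commute F Ω σ)

lemma locDbar_anticomm_locBracket : oddComm (locDbar Ω σ) (locBracket F Ω σ) = 0 :=
  map_sum_anticomm_eq_zero _ _ _ _ contrTheta_wedgeBar (dzbar_commute_mulFun_g F Ω σ)

lemma locDbar_anticomm_locDel : oddComm (locDbar Ω σ) (locDel F Ω σ) = 0 :=
  map_sum_anticomm_eq_zero _ _ _ _ contrTheta_wedgeBar (dzbar_commute_logDeriv F Ω σ)

/-- The function part is -θ̃_l(g_k) = -Σ_i ⟨ρ_i,e^k⟩⟨ρ_i,e^l⟩ z_i, symmetric in k and l, while the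
contractions are antisymmetric; the double sum cancels. -/
lemma locBracket_anticomm_locDel : oddComm (locBracket F Ω σ) (locDel F Ω σ) = 0 := by
  have h := map_sum_anticomm
    (fun k => mulFun (U := dom Ω σ) (g F σ k) (contDiff_g F σ k).contDiffOn) (contrTheta (n := n) σ)
    (logDeriv F Ω σ) (contrTheta σ) contrTheta_anticomm
  refine h.trans ?_
  set S : Module.End ℂ (LocPV n Ω σ) := ∑ k, ∑ l, TensorProduct.map
    (mulFun (U := dom Ω σ) (g F σ k) (contDiff_g F σ k).contDiffOn * logDeriv F Ω σ l -
      logDeriv F Ω σ l * mulFun (U := dom Ω σ) (g F σ k) (contDiff_g F σ k).contDiffOn)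
    (contrTheta σ k * contrTheta σ l) with hS
  -- Exchanging the names k and l of the summation indices reverses the sign.
  have hneg : S = -S := by
    conv_lhs => rw [hS, Finset.sum_comm]
    rw [hS, ← Finset.sum_neg_distrib]
    refine Finset.sum_congr rfl fun k _ => ?_
    rw [← Finset.sum_neg_distrib]
    refine Finset.sum_congr rfl fun l _ => ?_
    rw [logDeriv_mul_mulFun_g, logDeriv_mul_mulFun_g, contrTheta_anticomm]
    simp only [mul_comm (F.ray _ l : ℂ)]
    refine TensorProduct.ext' fun x y => ?_
    simp [TensorProduct.tmul_neg]
  have h2 : (2 : ℂ) • S = 0 := by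
    rw [two_smul]
    exact add_eq_zero_iff_eq_neg.2 hneg
  exact (smul_eq_zero.1 h2).resolve_left two_ne_zero

/-- The multiplications commute, so only the terms k = l of the canonical relation survive; their
coefficients add up to Σ g_k ḡ_k / Σ g_k ḡ_k, and the denominator has no zero off the origin. -/
lemma locBracket_anticomm_locVf (hσ : σ ∈ F.cones) :
    oddComm (locBracket F (punctured d) σ) (locVf F σ hσ) = 1 := by
  have key : ∀ k l : Fin n, ∀ (a b : Module.End ℂ (Smooth (dom (punctured d) σ))), Commute a b →
      (TensorProduct.map a (contrTheta (n := n) σ k) * TensorProduct.map b (wedgeTheta σ l) +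
        TensorProduct.map b (wedgeTheta σ l) * TensorProduct.map a (contrTheta σ k) :
          Module.End ℂ (LocPV n (punctured d) σ)) =
      if k = l then TensorProduct.map (a * b) 1 else 0 := by
    intro k l a b hab
    rw [← TensorProduct.map_mul, ← TensorProduct.map_mul, contrTheta_wedgeTheta, ← hab.eq,
      ← TensorProduct.map_add_right, sub_add_cancel]
    split_ifs
    · rw [one_smul]
    · rw [zero_smul, TensorProduct.map_zero_right]
  rw [oddComm, locBracket, locVf, Finset.sum_mul_sum, Finset.sum_mul_sum,
    Finset.sum_comm (f := fun l k => TensorProduct.map _ (wedgeTheta σ l) * _),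
    ← Finset.sum_add_distrib]
  simp only [← Finset.sum_add_distrib]
  simp only [key _ _ _ _ (mulFun_commute _ _), Finset.sum_ite_eq, Finset.mem_univ, if_true]
  refine TensorProduct.ext' fun f x => ?_
  rw [LinearMap.sum_apply]
  simp only [TensorProduct.map_tmul, Module.End.one_apply, ← TensorProduct.sum_tmul]
  congr 1
  refine smooth_ext fun w hw => ?_
  have h0 := gNorm_ne_zero F hσ hw
  simp only [Module.End.mul_apply, Submodule.coe_sum, Finset.sum_apply, mulFun_apply,
    ← mul_assoc, ← Finset.sum_mul, mul_div_assoc', ← Finset.sum_div]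
  rw [← gNorm, div_self h0, one_mul]

/-- By the Leibniz rule this is multiplication by Σ ∂̄_i(ḡ_k / Σ g_m ḡ_m) dz̄_i θ̃_k. The even
elements dz̄_i θ̃_k commute and have square zero, and a finite sum of commuting nilpotents is
nilpotent. -/
lemma isNilpotent_locDbar_anticomm_locVf (hσ : σ ∈ F.cones) :
    IsNilpotent (oddComm (locDbar (punctured d) σ) (locVf F σ hσ)) := by
  rw [locDbar, locVf, map_sum_anticomm _ _ _ _ wedgeTheta_wedgeBar]
  have hA : ∀ (i : σ) (k : Fin n), ∃ χ : (σ → ℂ) → ℂ,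
      ∃ hχ : ContDiffOn ℝ ∞ χ (dom (punctured d) σ),
      (dzbar i * mulFun _ (contDiffOn_vf F hσ k) - mulFun _ (contDiffOn_vf F hσ k) * dzbar i :
        Module.End ℂ (Smooth (dom (punctured d) σ))) = mulFun χ hχ := by
    intro i k
    refine ⟨_, contDiffOn_wirtFun Complex.I i (contDiffOn_vf F hσ k), ?_⟩
    rw [dzbar, wirtinger_mul_mulFun]
    exact add_sub_cancel_left (G := Module.End ℂ (Smooth (dom (punctured d) σ))) _ _
  choose χ hχ hA using hA
  simp only [hA]
  rw [← Finset.sum_product']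
  have hB : ∀ (i j : σ) (k l : Fin n), Commute (wedgeBar σ i * wedgeTheta σ k)
      (wedgeBar σ j * wedgeTheta σ l : Module.End ℂ (Ext n σ)) := by
    intro i j k l
    exact commute_mul_mul_of_anticomm (wedgeTheta_wedgeBar j k) (wedgeTheta_wedgeBar i l)
      (wedgeBar_anticomm i j) (wedgeTheta_anticomm k l)
  refine Commute.isNilpotent_sum (fun p _ => ⟨2, ?_⟩) (fun p q _ _ => ?_)
  · have hsq : (wedgeBar σ p.1 * wedgeTheta σ p.2) * (wedgeBar σ p.1 * wedgeTheta σ p.2) =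
        (0 : Module.End ℂ (Ext n σ)) :=
      mul_mul_self_eq_zero_of_anticomm (wedgeTheta_wedgeBar p.1 p.2) (wedgeBar_sq p.1)
    rw [pow_two, ← TensorProduct.map_mul, hsq, TensorProduct.map_zero_right]
  · rw [commute_iff_eq, ← TensorProduct.map_mul, ← TensorProduct.map_mul,
      (mulFun_commute _ _).eq, (hB _ _ _ _).eq]

end LocalIdentities

/-! ### Identities between the global operators -/

section GlobalIdentities

variable {n d : ℕ} {F : ProjFan n d} {Ω Ω' : TopologicalSpace.Opens (Fin d → ℂ)}

/-- Glued operators act component by component, so relations need only be checked on each X_σ. -/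
lemma oddComm_glue_eq_zero {L M : ∀ σ ∈ F.cones, LocPV n Ω σ →ₗ[ℂ] LocPV n Ω σ}
    (hL : ∀ (η σ : Finset (Fin d)) (hη : η ∈ F.cones) (hσ : σ ∈ F.cones) (h : η ⊆ σ)
      (y : LocPV n Ω σ), pull h (L σ hσ y) = L η hη (pull h y))
    (hM : ∀ (η σ : Finset (Fin d)) (hη : η ∈ F.cones) (hσ : σ ∈ F.cones) (h : η ⊆ σ)
      (y : LocPV n Ω σ), pull h (M σ hσ y) = M η hη (pull h y))
    (h : ∀ σ hσ, oddComm (L σ hσ) (M σ hσ) = 0) : oddComm (glue L hL) (glue M hM) = 0 :=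
  LinearMap.ext fun α => Subtype.ext (funext fun σ => LinearMap.congr_fun (h σ.1 σ.2.1) (α.1 σ))

variable (F Ω)

lemma dbar_anticomm_self : oddComm (dbar F Ω) (dbar F Ω) = 0 :=
  oddComm_glue_eq_zero _ _ fun σ _ => locDbar_anticomm_self Ω σ

lemma bracketF_anticomm_self : oddComm (bracketF F Ω) (bracketF F Ω) = 0 :=
  oddComm_glue_eq_zero _ _ fun σ _ => locBracket_anticomm_self F Ω σ

lemma del_anticomm_self : oddComm (del F Ω) (del F Ω) = 0 :=
  oddComm_glue_eq_zero _ _ fun σ _ => locDel_anticomm_self F Ω σ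

lemma dbar_anticomm_bracketF : oddComm (dbar F Ω) (bracketF F Ω) = 0 :=
  oddComm_glue_eq_zero _ _ fun σ _ => locDbar_anticomm_locBracket F Ω σ

lemma dbar_anticomm_del : oddComm (dbar F Ω) (del F Ω) = 0 :=
  oddComm_glue_eq_zero _ _ fun σ _ => locDbar_anticomm_locDel F Ω σ

lemma bracketF_anticomm_del : oddComm (bracketF F Ω) (del F Ω) = 0 :=
  oddComm_glue_eq_zero _ _ fun σ _ => locBracket_anticomm_locDel F Ω σ

lemma dbarF_mul_self : dbarF F Ω * dbarF F Ω = 0 := by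
  have h1 := mul_self_eq_zero_of_oddComm (dbar_anticomm_self F Ω)
  have h2 := mul_self_eq_zero_of_oddComm (bracketF_anticomm_self F Ω)
  have h3 := dbar_anticomm_bracketF F Ω
  rw [oddComm] at h3
  rw [dbarF, add_mul, mul_add, mul_add, h1, h2, zero_add, add_zero, h3]

lemma del_mul_self : del F Ω * del F Ω = 0 :=
  mul_self_eq_zero_of_oddComm (del_anticomm_self F Ω)

lemma dbarF_anticomm_del : oddComm (dbarF F Ω) (del F Ω) = 0 := by
  have h1 := dbar_anticomm_del F Ω
  have h2 := bracketF_anticomm_del F Ω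
  rw [oddComm] at h1 h2 ⊢
  rw [dbarF, add_mul, mul_add, add_add_add_comm, h1, h2, add_zero]

lemma bracketF_anticomm_Vf : oddComm (bracketF F (punctured d)) (Vf F) = 1 :=
  LinearMap.ext fun α => Subtype.ext (funext fun σ =>
    LinearMap.congr_fun (locBracket_anticomm_locVf F σ.1 σ.2.1) (α.1 σ))

/-- {f,-} contains no derivative of the coefficients. This is why [D_f, ρ] reduces to [D, ρ] in the
formula for T. -/
lemma bracketF_commute_mulBy (r : (Fin d → ℂ) → ℝ) (hr : ContDiff ℝ ∞ r) :
    Commute (bracketF F Ω) (mulBy F Ω r hr) := by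
  have h : ∀ σ, Commute (locBracket F Ω σ) (locMul Ω r hr σ : Module.End ℂ (LocPV n Ω σ)) := by
    intro σ
    refine Commute.sum_left _ _ _ fun k _ => ?_
    rw [locMul, commute_iff_eq, ← TensorProduct.map_mul, ← TensorProduct.map_mul]
    exact congrArg₂ TensorProduct.map (mulFun_commute _ _).eq rfl
  exact LinearMap.ext fun α => Subtype.ext (funext fun σ => LinearMap.congr_fun (h σ.1) (α.1 σ))

lemma isNilpotent_dbar_anticomm_Vf : IsNilpotent (oddComm (dbar F (punctured d)) (Vf F)) := by
  choose m hm using fun σ : F.MaxCone => isNilpotent_locDbar_anticomm_locVf F σ.1 σ.2.1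
  have hp : ∀ (j : ℕ) (α : PV F (punctured d)) (σ : F.MaxCone),
      (((oddComm (dbar F (punctured d)) (Vf F)) ^ j) α).1 σ =
        ((oddComm (locDbar (punctured d) σ.1) (locVf F σ.1 σ.2.1)) ^ j) (α.1 σ) := by
    intro j
    induction j with
    | zero => intro α σ; rfl
    | succ j ih =>
      intro α σ
      rw [pow_succ, pow_succ, Module.End.mul_apply, Module.End.mul_apply, ih]
      rfl
  -- There are finitely many components, so the largest of their nilpotency exponents works for all.
  have : Fintype F.MaxCone := Fintype.ofFinite _
  refine ⟨Finset.univ.sup m, LinearMap.ext fun α => Subtype.ext (funext fun σ => ?_)⟩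
  rw [hp, pow_eq_zero_of_le (Finset.le_sup (Finset.mem_univ σ)) (hm σ)]
  rfl

end GlobalIdentities

/-! ### Restriction to the complement of the origin -/

section Restriction

variable {n d : ℕ} (F : ProjFan n d) {Ω Ω' : TopologicalSpace.Opens (Fin d → ℂ)} (h : Ω' ≤ Ω)
  (σ : Finset (Fin d))

lemma restrictFun_apply (f : Smooth (dom Ω σ)) {w : σ → ℂ} (hw : w ∈ dom Ω' σ) :
    (restrictFun h σ f).1 w = f.1 w := if_pos hw

lemma dom_mono {Ω Ω' : TopologicalSpace.Opens (Fin d → ℂ)} (h : Ω' ≤ Ω) {w : σ → ℂ} (hw : w ∈ dom Ω' σ) : w ∈ dom Ω σ := h hw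

lemma restrictFun_mulFun {χ : (σ → ℂ) → ℂ} (hχ : ContDiffOn ℝ ∞ χ (dom Ω σ))
    (hχ' : ContDiffOn ℝ ∞ χ (dom Ω' σ)) :
    restrictFun h σ ∘ₗ mulFun χ hχ = mulFun χ hχ' ∘ₗ restrictFun h σ := by
  refine LinearMap.ext fun f => smooth_ext fun w hw => ?_
  simp only [LinearMap.comp_apply, mulFun_apply, restrictFun_apply h σ _ hw]

lemma restrictFun_wirtinger (ε : ℂ) (i : σ) :
    restrictFun h σ ∘ₗ wirtinger ε i = wirtinger ε i ∘ₗ restrictFun h σ := by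
  refine LinearMap.ext fun f => smooth_ext fun w hw => ?_
  have h1 : (restrictFun h σ f).1 =ᶠ[nhds w] f.1 := by
    filter_upwards [(dom Ω' σ).isOpen.mem_nhds hw] with w' hw' using restrictFun_apply h σ f hw'
  simp only [LinearMap.comp_apply, restrictFun_apply h σ _ hw]
  rw [wirtinger_apply _ _ _ (dom_mono σ h hw), wirtinger_apply _ _ _ hw, h1.fderiv_eq]

lemma restrictFun_logDeriv (k : Fin n) :
    restrictFun h σ ∘ₗ logDeriv F Ω σ k = logDeriv F Ω' σ k ∘ₗ restrictFun h σ := by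
  refine LinearMap.ext fun f => ?_
  simp only [logDeriv, LinearMap.comp_apply, LinearMap.sum_apply, map_sum]
  refine Finset.sum_congr rfl fun i _ => ?_
  rw [← LinearMap.comp_apply (restrictFun h σ),
    restrictFun_mulFun h σ _ (contDiff_coord σ i _).contDiffOn, LinearMap.comp_apply]
  exact congrArg _ (LinearMap.congr_fun (restrictFun_wirtinger h σ _ i) f)

lemma restrict_map {A : Smooth (dom Ω σ) →ₗ[ℂ] Smooth (dom Ω σ)}
    {A' : Smooth (dom Ω' σ) →ₗ[ℂ] Smooth (dom Ω' σ)}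
    (hA : restrictFun h σ ∘ₗ A = A' ∘ₗ restrictFun h σ) (B : Ext n σ →ₗ[ℂ] Ext n σ)
    (y : LocPV n Ω σ) :
    TensorProduct.map (restrictFun h σ) LinearMap.id (TensorProduct.map A B y) =
      TensorProduct.map A' B (TensorProduct.map (restrictFun h σ) LinearMap.id y) := by
  rw [← LinearMap.comp_apply, ← LinearMap.comp_apply, ← TensorProduct.map_comp,
    ← TensorProduct.map_comp, hA, LinearMap.id_comp, LinearMap.comp_id]

lemma toPunctured_dbar (α : PV F ⊤) :
    toPunctured F (dbar F ⊤ α) = dbar F (punctured d) (toPunctured F α) := by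
  refine Subtype.ext (funext fun σ => ?_)
  change TensorProduct.map (restrictFun le_top σ.1) LinearMap.id (locDbar ⊤ σ.1 (α.1 σ)) =
    locDbar (punctured d) σ.1 (TensorProduct.map (restrictFun le_top σ.1) LinearMap.id (α.1 σ))
  rw [locDbar, locDbar, LinearMap.sum_apply, LinearMap.sum_apply, map_sum]
  exact Finset.sum_congr rfl fun i _ =>
    restrict_map le_top σ.1 (restrictFun_wirtinger le_top σ.1 _ i) _ _

lemma toPunctured_bracketF (α : PV F ⊤) :
    toPunctured F (bracketF F ⊤ α) = bracketF F (punctured d) (toPunctured F α) := by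
  refine Subtype.ext (funext fun σ => ?_)
  change TensorProduct.map (restrictFun le_top σ.1) LinearMap.id (locBracket F ⊤ σ.1 (α.1 σ)) =
    locBracket F (punctured d) σ.1
      (TensorProduct.map (restrictFun le_top σ.1) LinearMap.id (α.1 σ))
  rw [locBracket, locBracket, LinearMap.sum_apply, LinearMap.sum_apply, map_sum]
  exact Finset.sum_congr rfl fun k _ =>
    restrict_map le_top σ.1 (restrictFun_mulFun le_top σ.1 _ _) _ _

lemma toPunctured_del (α : PV F ⊤) :
    toPunctured F (del F ⊤ α) = del F (punctured d) (toPunctured F α) := by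
  refine Subtype.ext (funext fun σ => ?_)
  change TensorProduct.map (restrictFun le_top σ.1) LinearMap.id (locDel F ⊤ σ.1 (α.1 σ)) =
    locDel F (punctured d) σ.1 (TensorProduct.map (restrictFun le_top σ.1) LinearMap.id (α.1 σ))
  rw [locDel, locDel, LinearMap.sum_apply, LinearMap.sum_apply, map_sum]
  exact Finset.sum_congr rfl fun k _ =>
    restrict_map le_top σ.1 (restrictFun_logDeriv F le_top σ.1 k) _ _

end Restriction

/-! ### Extension by zero over the origin -/

section Extension

variable {n d : ℕ} (F : ProjFan n d)

lemma contDiff_ofReal_comp_ext (χ : (Fin d → ℂ) → ℝ) (hχ : ContDiff ℝ ∞ χ) (σ : Finset (Fin d)) :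
    ContDiff ℝ ∞ (fun w => ((χ (ext σ w) : ℝ) : ℂ)) :=
  Complex.ofRealCLM.contDiff.comp (hχ.comp (ext σ).contDiff)

/-- Multiplication by a function `χ` that vanishes near the origin, as an operator from functions
on `ℂ^σ ∖ {0}` to functions on `ℂ^σ`. -/
def extendFun (χ : (Fin d → ℂ) → ℝ) (hχ : ContDiff ℝ ∞ χ)
    (h0 : ∀ᶠ z in nhds 0, χ z = 0) (σ : Finset (Fin d)) :
    Smooth (dom (punctured d) σ) →ₗ[ℂ] Smooth (dom ⊤ σ) where
  toFun f := ⟨fun w => ((χ (ext σ w) : ℝ) : ℂ) * f.1 w, by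
    refine ⟨fun w _ => ContDiffAt.contDiffWithinAt ?_, fun w hw => absurd trivial hw⟩
    by_cases hw : w ∈ dom (punctured d) σ
    · exact (contDiff_ofReal_comp_ext χ hχ σ).contDiffAt.mul (smooth_contDiffAt f hw)
    -- The only point outside the punctured domain is the origin, near which χ makes the product
    -- identically zero whatever f does.
    · have hw0 : ext σ w = 0 := not_not.1 hw
      have hz : ∀ᶠ w' in nhds w, χ (ext σ w') = 0 :=
        (ext σ).continuous.continuousAt.eventually (by rwa [hw0])
      refine (contDiffAt_const (c := (0 : ℂ))).congr_of_eventuallyEq ?_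
      filter_upwards [hz] with w' hw'
      rw [hw', Complex.ofReal_zero, zero_mul]⟩
  map_add' f g := by ext w; simp [mul_add]
  map_smul' c f := by ext w; simp [mul_left_comm]

lemma extendFun_apply (χ : (Fin d → ℂ) → ℝ) (hχ : ContDiff ℝ ∞ χ)
    (h0 : ∀ᶠ z in nhds 0, χ z = 0) (σ : Finset (Fin d)) (f : Smooth (dom (punctured d) σ)) (w : σ → ℂ) :
    (extendFun χ hχ h0 σ f).1 w = ((χ (ext σ w) : ℝ) : ℂ) * f.1 w := rfl

/-- Multiplication by a function `χ` that vanishes near the origin, as an operator from polyvector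
fields on `X ∖ {0}` to polyvector fields on `X`. -/
def extendBy (χ : (Fin d → ℂ) → ℝ) (hχ : ContDiff ℝ ∞ χ)
    (h0 : ∀ᶠ z in nhds 0, χ z = 0) :
    PV F (punctured d) →ₗ[ℂ] PV F ⊤ :=
  glue (fun σ _ => TensorProduct.map (extendFun χ hχ h0 σ) LinearMap.id) (by
    intro η σ _ _ h y
    refine pull_map _ h _ _ _ _ (fun f => ?_) (fun _ => rfl) y
    ext w
    simp [resFun, extendFun, ext_proj_ext h])

lemma toPunctured_comp_extendBy (χ : (Fin d → ℂ) → ℝ) (hχ : ContDiff ℝ ∞ χ)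
    (h0 : ∀ᶠ z in nhds 0, χ z = 0) :
    toPunctured F ∘ₗ extendBy F χ hχ h0 = mulBy F (punctured d) χ hχ := by
  have h : ∀ σ, restrictFun le_top σ ∘ₗ extendFun χ hχ h0 σ =
      mulFun (fun w => ((χ (ext σ w) : ℝ) : ℂ))
        (contDiff_ofReal_comp_ext χ hχ σ).contDiffOn := by
    refine fun σ => LinearMap.ext fun f => smooth_ext fun w hw => ?_
    rw [LinearMap.comp_apply, restrictFun_apply _ _ _ hw]
    rfl
  refine LinearMap.ext fun α => Subtype.ext (funext fun σ => ?_)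
  change TensorProduct.map (restrictFun le_top σ.1) LinearMap.id
    (TensorProduct.map (extendFun χ hχ h0 σ.1) LinearMap.id (α.1 σ)) = locMul _ χ hχ σ.1 (α.1 σ)
  rw [← LinearMap.comp_apply, ← TensorProduct.map_comp, h]
  rfl

/-- Shows that the factor χ, needed to extend over the origin, does not alter a formula that begins
with 1 - ρ. -/
lemma mulBy_mul_one_sub (Ω : TopologicalSpace.Opens (Fin d → ℂ)) (χ : (Fin d → ℂ) → ℝ)
    (hχ : ContDiff ℝ ∞ χ) (r : (Fin d → ℂ) → ℝ)
    (hr : ContDiff ℝ ∞ r) (h : ∀ z, χ z * (1 - r z) = 1 - r z) :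
    mulBy F Ω χ hχ * (1 - mulBy F Ω r hr) = 1 - mulBy F Ω r hr := by
  have key : ∀ σ (y : LocPV n Ω σ), locMul Ω χ hχ σ (y - locMul Ω r hr σ y) =
      y - locMul Ω r hr σ y := by
    intro σ y
    induction y using TensorProduct.induction_on with
    | zero => simp only [map_zero, sub_zero]
    | tmul f x =>
      simp only [locMul, TensorProduct.map_tmul, LinearMap.id_apply, ← TensorProduct.sub_tmul]
      congr 1
      ext w
      have := congrArg (fun t : ℝ => (t : ℂ)) (h (ext σ w))
      push_cast at this
      change ((χ (ext σ w) : ℝ) : ℂ) * (f.1 w - ((r (ext σ w) : ℝ) : ℂ) * f.1 w) =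
        f.1 w - ((r (ext σ w) : ℝ) : ℂ) * f.1 w
      linear_combination f.1 w * this
    | add y z hy hz =>
      have e : y + z - locMul Ω r hr σ (y + z) =
          (y - locMul Ω r hr σ y) + (z - locMul Ω r hr σ z) := by
        rw [map_add]; abel
      rw [e, map_add, hy, hz]
  exact LinearMap.ext fun α => Subtype.ext (funext fun σ => key σ.1 (α.1 σ))

end Extension

/-! ### Supports -/

section Support

variable {n d : ℕ} {F : ProjFan n d} {Ω Ω' Ω'' : TopologicalSpace.Opens (Fin d → ℂ)}

/-- The coefficient functions of a polyvector field. -/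
def coeffFun {σ : Finset (Fin d)} (φ : Module.Dual ℂ (Ext n σ)) :
    LocPV n Ω σ →ₗ[ℂ] Smooth (dom Ω σ) :=
  (TensorProduct.rid ℂ _).toLinearMap ∘ₗ TensorProduct.map LinearMap.id φ

lemma coeffFun_apply {σ : Finset (Fin d)} (φ : Module.Dual ℂ (Ext n σ)) (y : LocPV n Ω σ)
    (w : σ → ℂ) : (coeffFun φ y).1 w = φ (evalAt w y) := by
  induction y using TensorProduct.induction_on with
  | zero => simp only [map_zero]; rfl
  | tmul f x => simp [coeffFun, evalAt, mul_comm]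
  | add y z hy hz =>
    rw [map_add, map_add, map_add, ← hy, ← hz]
    rfl

lemma coeffFun_map {σ : Finset (Fin d)} (φ : Module.Dual ℂ (Ext n σ))
    (A : Smooth (dom Ω σ) →ₗ[ℂ] Smooth (dom Ω' σ)) (B : Ext n σ →ₗ[ℂ] Ext n σ)
    (y : LocPV n Ω σ) :
    coeffFun φ (TensorProduct.map A B y) = A (coeffFun (φ ∘ₗ B) y) := by
  induction y using TensorProduct.induction_on with
  | zero => simp only [map_zero]
  | tmul f x => simp [coeffFun]
  | add y z hy hz => simp only [map_add, hy, hz]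

/-- Linear functionals separate the points of the exterior algebra, so supports can be tested on
scalar coefficients; there `coeffFun_map` lets A ⊗ B act through A alone. -/
lemma evalAt_eq_zero_iff {σ : Finset (Fin d)} (y : LocPV n Ω σ) (w : σ → ℂ) :
    evalAt w y = 0 ↔ ∀ φ : Module.Dual ℂ (Ext n σ), (coeffFun φ y).1 w = 0 := by
  simp only [coeffFun_apply]
  exact (Module.forall_dual_apply_eq_zero_iff ℂ _).symm

/-- An operator on polyvector fields over `ℂ^σ` that does not enlarge supports. -/
def LocalOp {σ : Finset (Fin d)} (L : LocPV n Ω σ →ₗ[ℂ] LocPV n Ω' σ) : Prop :=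
  ∀ (y : LocPV n Ω σ) (W : Set (σ → ℂ)), IsOpen W → (∀ w ∈ W, evalAt w y = 0) →
    ∀ w ∈ W, evalAt w (L y) = 0

lemma LocalFun.map {σ : Finset (Fin d)} {A : Smooth (dom Ω σ) →ₗ[ℂ] Smooth (dom Ω' σ)}
    (hA : LocalFun A) (B : Ext n σ →ₗ[ℂ] Ext n σ) : LocalOp (TensorProduct.map A B) := by
  intro y W hW hy w hw
  rw [evalAt_eq_zero_iff]
  intro φ
  rw [coeffFun_map]
  exact hA _ W hW (fun w hw => (evalAt_eq_zero_iff _ _).1 (hy w hw) _) w hw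

lemma LocalOp.sum {σ : Finset (Fin d)} {ι : Type*} (s : Finset ι)
    {L : ι → LocPV n Ω σ →ₗ[ℂ] LocPV n Ω' σ} (h : ∀ i, LocalOp (L i)) :
    LocalOp (∑ i ∈ s, L i) := by
  intro y W hW hy w hw
  rw [LinearMap.sum_apply, map_sum]
  exact Finset.sum_eq_zero fun i _ => h i y W hW hy w hw

variable (F Ω) in
/-- The polyvector fields supported in `K ⊆ ℂᵈ`. -/
def supportedIn (K : Set (Fin d → ℂ)) : Submodule ℂ (PV F Ω) where
  carrier := {α | ∀ (σ : F.MaxCone) (w : σ.1 → ℂ), ext σ.1 w ∉ K → evalAt w (α.1 σ) = 0}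
  zero_mem' := fun σ w _ => by simp
  add_mem' := fun {α β} hα hβ σ w hw => by simp [hα σ w hw, hβ σ w hw]
  smul_mem' := fun c α hα σ w hw => by simp [hα σ w hw]

/-- An operator on polyvector fields that does not enlarge supports. -/
def SupportLocal (L : PV F Ω →ₗ[ℂ] PV F Ω') : Prop :=
  ∀ K, IsClosed K → ∀ α ∈ supportedIn F Ω K, L α ∈ supportedIn F Ω' K

lemma supportLocal_glue {L : ∀ σ ∈ F.cones, LocPV n Ω σ →ₗ[ℂ] LocPV n Ω' σ}
    (hL : ∀ (η σ : Finset (Fin d)) (hη : η ∈ F.cones) (hσ : σ ∈ F.cones) (h : η ⊆ σ)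
      (y : LocPV n Ω σ), pull h (L σ hσ y) = L η hη (pull h y))
    (h : ∀ σ hσ, LocalOp (L σ hσ)) : SupportLocal (glue L hL) := fun K hK α hα σ w hw =>
  h σ.1 σ.2.1 (α.1 σ) (ext σ.1 ⁻¹' Kᶜ) (hK.isOpen_compl.preimage (ext σ.1).continuous)
    (fun w hw => hα σ w hw) w hw

lemma SupportLocal.comp {L : PV F Ω' →ₗ[ℂ] PV F Ω''} {M : PV F Ω →ₗ[ℂ] PV F Ω'}
    (hL : SupportLocal L) (hM : SupportLocal M) : SupportLocal (L ∘ₗ M) :=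
  fun K hK α hα => hL K hK _ (hM K hK α hα)

lemma SupportLocal.add {L M : PV F Ω →ₗ[ℂ] PV F Ω'}
    (hL : SupportLocal L) (hM : SupportLocal M) : SupportLocal (L + M) :=
  fun K hK α hα => add_mem (hL K hK α hα) (hM K hK α hα)

lemma SupportLocal.oddComm {L M : Module.End ℂ (PV F Ω)}
    (hL : SupportLocal L) (hM : SupportLocal M) : SupportLocal (oddComm L M) :=
  SupportLocal.add (hL.comp hM) (hM.comp hL)

variable (F Ω)

lemma supportLocal_dbar : SupportLocal (dbar F Ω) :=
  supportLocal_glue _ fun _ _ => LocalOp.sum _ fun i => (localFun_wirtinger _ i).map _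

lemma supportLocal_bracketF : SupportLocal (bracketF F Ω) :=
  supportLocal_glue _ fun _ _ => LocalOp.sum _ fun _ => (localFun_mulFun _).map _

lemma supportLocal_del : SupportLocal (del F Ω) :=
  supportLocal_glue _ fun σ _ => LocalOp.sum _ fun k => (localFun_logDeriv F Ω σ k).map _

lemma supportLocal_dbarF : SupportLocal (dbarF F Ω) :=
  (supportLocal_dbar F Ω).add (supportLocal_bracketF F Ω)

lemma supportLocal_mulBy (r : (Fin d → ℂ) → ℝ) (hr : ContDiff ℝ ∞ r) :
    SupportLocal (mulBy F Ω r hr) :=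
  supportLocal_glue _ fun _ _ => (localFun_mulFun _).map _

lemma supportLocal_Vf : SupportLocal (Vf F) :=
  supportLocal_glue _ fun _ _ => LocalOp.sum _ fun _ => (localFun_mulFun _).map _

lemma supportLocal_toPunctured : SupportLocal (toPunctured F) := by
  refine supportLocal_glue _ fun σ _ => LocalFun.map (fun f W _ hf w hw => ?_) _
  by_cases h : w ∈ dom (punctured d) σ
  · rw [restrictFun_apply _ _ _ h, hf w hw]
  · exact (restrictFun le_top σ f).2.2 w h

lemma supportLocal_extendBy (χ : (Fin d → ℂ) → ℝ) (hχ : ContDiff ℝ ∞ χ)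
    (h0 : ∀ᶠ z in nhds 0, χ z = 0) : SupportLocal (extendBy F χ hχ h0) := by
  refine supportLocal_glue _ fun σ _ => LocalFun.map (fun f W _ hf w hw => ?_) _
  rw [extendFun_apply, hf w hw, mul_zero]

lemma extendBy_mem_supportedIn (χ : (Fin d → ℂ) → ℝ) (hχ : ContDiff ℝ ∞ χ)
    (h0 : ∀ᶠ z in nhds 0, χ z = 0) (β : PV F (punctured d)) :
    extendBy F χ hχ h0 β ∈ supportedIn F ⊤ (tsupport χ) := by
  intro σ w hw
  rw [evalAt_eq_zero_iff]
  intro φ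
  change (coeffFun φ (TensorProduct.map (extendFun χ hχ h0 σ.1) LinearMap.id (β.1 σ))).1 w = 0
  rw [coeffFun_map, extendFun_apply, image_eq_zero_of_notMem_tsupport hw, Complex.ofReal_zero,
    zero_mul]

lemma mulBy_mem_supportedIn (r : (Fin d → ℂ) → ℝ) (hr : ContDiff ℝ ∞ r) (β : PV F Ω) :
    mulBy F Ω r hr β ∈ supportedIn F Ω (tsupport r) := by
  intro σ w hw
  rw [evalAt_eq_zero_iff]
  intro φ
  change (coeffFun φ (locMul Ω r hr σ.1 (β.1 σ))).1 w = 0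
  rw [locMul, coeffFun_map]
  refine (mulFun_apply _ _ _ _).trans ?_
  rw [image_eq_zero_of_notMem_tsupport hw, Complex.ofReal_zero, zero_mul]

variable {F Ω}

/-- Since K contains the origin, the one point lost by restriction carries no support condition. -/
lemma mem_supportedIn_of_toPunctured {K : Set (Fin d → ℂ)} (h0 : 0 ∈ K) {α : PV F ⊤}
    (h : toPunctured F α ∈ supportedIn F (punctured d) K) : α ∈ supportedIn F ⊤ K := by
  intro σ w hw
  have hd : w ∈ dom (punctured d) σ.1 := fun h' : ext σ.1 w = 0 => hw (h'.symm ▸ h0)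
  have := h σ w hw
  rw [evalAt_eq_zero_iff] at this ⊢
  intro φ
  have h1 := this φ
  change (coeffFun φ (TensorProduct.map (restrictFun le_top σ.1) LinearMap.id (α.1 σ))).1 w = 0
    at h1
  rw [coeffFun_map, restrictFun_apply _ _ _ hd] at h1
  exact h1

lemma atOrigin_eq_zero {K : Set (Fin d → ℂ)} (h0 : 0 ∉ K) {α : PV F ⊤}
    (h : α ∈ supportedIn F ⊤ K) : atOrigin F α = 0 :=
  funext fun σ => h σ 0 (by rwa [map_zero])

variable (F Ω) in
/-- The polyvector fields on `X ∩ Ω` that vanish outside of a compact subset of `ℂᵈ`. -/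
def boundedSupport : Submodule ℂ (PV F Ω) where
  carrier := {α | ∃ K, IsCompact K ∧ α ∈ supportedIn F Ω K}
  zero_mem' := ⟨∅, isCompact_empty, zero_mem _⟩
  add_mem' := fun {α β} ⟨K, hK, hα⟩ ⟨K', hK', hβ⟩ => by
    refine ⟨K ∪ K', hK.union hK', fun σ w hw => ?_⟩
    have h1 := hα σ w (fun h => hw (Or.inl h))
    have h2 := hβ σ w (fun h => hw (Or.inr h))
    simp [h1, h2]
  smul_mem' := fun c _ ⟨K, hK, hα⟩ => ⟨K, hK, Submodule.smul_mem _ c hα⟩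

lemma SupportLocal.map_boundedSupport {L : PV F Ω →ₗ[ℂ] PV F Ω'} (hL : SupportLocal L) :
    ∀ α ∈ boundedSupport F Ω, L α ∈ boundedSupport F Ω' :=
  fun α ⟨K, hK, hα⟩ => ⟨K, hK, hL K hK.isClosed α hα⟩

lemma proj_ext_self (σ : Finset (Fin d)) (w : σ → ℂ) : proj σ (ext σ w) = w := by
  funext i
  simp [proj, ext]

lemma mem_boundedSupport_of_mem_PVc {α : PV F ⊤} (hα : α ∈ PVc F) : α ∈ boundedSupport F ⊤ := by
  have h : ∀ σ : F.MaxCone, ∃ K : Set (Fin d → ℂ), IsCompact K ∧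
      ∀ w : σ.1 → ℂ, ext σ.1 w ∉ K → evalAt w (α.1 σ) = 0 := by
    intro σ
    obtain ⟨K, hK, hz⟩ := hα σ
    exact ⟨ext σ.1 '' K, hK.image (ext σ.1).continuous,
      fun w hw => hz w fun h => hw (Set.mem_image_of_mem _ h)⟩
  choose K hK hz using h
  refine ⟨⋃ σ, K σ, isCompact_iUnion hK, ?_⟩
  intro σ w hw
  exact hz σ w fun h => hw (Set.mem_iUnion_of_mem σ h)

lemma mem_PVc_of_mem_boundedSupport {α : PV F ⊤} (hα : α ∈ boundedSupport F ⊤) : α ∈ PVc F := by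
  obtain ⟨K, hK, hz⟩ := hα
  intro σ
  refine ⟨proj σ.1 '' K, hK.image (proj σ.1).continuous, fun w hw => ?_⟩
  refine hz σ w fun h => hw ?_
  exact ⟨ext σ.1 w, h, proj_ext_self σ.1 w⟩

variable (F) in
-- The union of the images of finitely many compact sets is one compact subset of ℂᵈ. The uniform
-- condition also makes sense over X ∖ {0}, where K may contain the origin and the field may be
-- singular there.
lemma PVc_eq_boundedSupport : PVc F = boundedSupport F ⊤ :=
  le_antisymm (fun _ => mem_boundedSupport_of_mem_PVc) fun _ => mem_PVc_of_mem_boundedSupport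

end Support

/-! ### The homotopy formula -/

section HomotopyFormula

variable {W W' X : Type*} [AddCommGroup W] [Module ℂ W] [AddCommGroup W'] [Module ℂ W']
  [AddCommGroup X] [Module ℂ X]

/-- With A = D + b and P = [A, v], the relation A² = 0 gives AP = AvA = PA, so A commutes with P⁻¹
and [A, vP⁻¹] = 1. Multiplying vP⁻¹ by 1 - ρ adds the single term -[A, ρ]vP⁻¹. -/
lemma oddComm_formulaR {D b v ρ : Module.End ℂ W} (hsq : (D + b) * (D + b) = 0)
    (hbv : oddComm b v = 1) (hbρ : Commute b ρ) (hP : IsUnit (1 + oddComm D v)) :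
    oddComm (D + b) (formulaR D v ρ) = 1 - formulaT D v ρ := by
  have hDf : (D + b) * v + v * (D + b) = 1 + oddComm D v := by
    rw [← hbv, oddComm, oddComm]
    noncomm_ring
  rw [formulaR, formulaT]
  have hρ : D * ρ - ρ * D = (D + b) * ρ - ρ * (D + b) := by
    rw [add_mul, mul_add, hbρ.eq]
    abel
  rw [hρ]
  generalize D + b = A at *
  generalize 1 + oddComm D v = P at *
  have hPP : P * Ring.inverse P = 1 := Ring.mul_inverse_cancel P hP
  have hPP' : Ring.inverse P * P = 1 := Ring.inverse_mul_cancel P hP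
  generalize Ring.inverse P = P' at *
  have hAP : A * P = P * A := by
    rw [← hDf, mul_add, add_mul, ← mul_assoc, hsq, mul_assoc v, hsq, mul_zero, zero_mul, zero_add,
      add_zero, mul_assoc]
  have hAP' : A * P' = P' * A := by
    calc A * P' = P' * P * A * P' := by rw [hPP', one_mul]
      _ = P' * (A * P) * P' := by rw [hAP, mul_assoc P' P A]
      _ = P' * A := by rw [mul_assoc, mul_assoc, hPP, mul_one]
  have hv : v * A = P - A * v := by rw [← hDf]; abel
  calc oddComm A ((1 - ρ) * v * P')
      = A * (1 - ρ) * v * P' + (1 - ρ) * (v * A) * P' := by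
        rw [oddComm, mul_assoc _ P' A, ← hAP']
        simp only [mul_assoc]
    _ = (1 - ρ) * (P * P') - (A * ρ - ρ * A) * v * P' := by rw [hv]; noncomm_ring
    _ = 1 - (ρ + (A * ρ - ρ * A) * v * P') := by rw [hPP]; noncomm_ring

/-- The homotopy on `X`, obtained from the formulas on the complement of the origin by extension
by zero. -/
lemma exists_homotopy {D b v ρ χ : Module.End ℂ W'} {A : Module.End ℂ W} (res : W →ₗ[ℂ] W')
    (E : W' →ₗ[ℂ] W) (O : W →ₗ[ℂ] X) (C Z : Submodule ℂ W) (B S : Submodule ℂ W')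
    (hsq : (D + b) * (D + b) = 0) (hbv : oddComm b v = 1) (hbρ : Commute b ρ)
    (hP : IsUnit (1 + oddComm D v))
    (hres : ∀ α, res (A α) = (D + b) (res α)) (hE : res ∘ₗ E = χ) (hχ : χ * (1 - ρ) = 1 - ρ)
    (hO : ∀ α ∈ Z, O α = 0) (hAZ : ∀ α ∈ Z, A α ∈ Z) (hEZ : ∀ β, E β ∈ Z)
    (hS : ∀ α, res α ∈ S → α ∈ C) (hρS : ∀ β, ρ β ∈ S) (hDS : ∀ β ∈ S, D β ∈ S)
    (hresB : ∀ α ∈ C, res α ∈ B) (hEB : ∀ β ∈ B, E β ∈ C) (hvB : ∀ β ∈ B, v β ∈ B)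
    (hρB : ∀ β ∈ B, ρ β ∈ B) (hPB : ∀ β, (1 + oddComm D v) β ∈ B → β ∈ B) :
    ∃ T R : Module.End ℂ W,
      (∀ α, res (T α) = formulaT D v ρ (res α)) ∧ (∀ α, res (R α) = formulaR D v ρ (res α)) ∧
      (∀ α, O (T α) = O α) ∧ (∀ α, O (R α) = 0) ∧ (∀ α, T α ∈ C) ∧ (∀ α ∈ C, R α ∈ C) ∧
      oddComm A R = 1 - T := by
  -- In the application W and W' are the fields on X and X ∖ {0}. Z consists of fields supported
  -- away from the origin, S of fields supported in supp ρ, and C and B of fields with support in a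
  -- compact subset of ℂᵈ.
  set R : Module.End ℂ W := E ∘ₗ formulaR D v ρ ∘ₗ res with hR
  have hresR : ∀ α, res (R α) = formulaR D v ρ (res α) := by
    intro α
    change (res ∘ₗ E) (formulaR D v ρ (res α)) = _
    rw [hE, formulaR, ← Module.End.mul_apply, ← mul_assoc, ← mul_assoc, hχ]
  have hresT : ∀ α, res ((1 - oddComm A R) α) = formulaT D v ρ (res α) := by
    intro α
    have h := LinearMap.congr_fun (oddComm_formulaR hsq hbv hbρ hP) (res α)
    have h1 : (oddComm (D + b) (formulaR D v ρ)) (res α) =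
        (D + b) (formulaR D v ρ (res α)) + formulaR D v ρ ((D + b) (res α)) := rfl
    have h2 : (1 - oddComm A R) α = α - (A (R α) + R (A α)) := rfl
    rw [h2, map_sub, map_add, hres, hresR, hresR, hres, ← h1, h]
    exact sub_sub_cancel _ _
  have hRZ : ∀ α, R α ∈ Z := fun α => hEZ _
  -- Defining T by the homotopy identity makes that identity automatic and avoids extending formula
  -- T over the origin separately.
  refine ⟨1 - oddComm A R, R, hresT, hresR, fun α => ?_, fun α => hO _ (hRZ _), fun α => ?_,
    fun α hα => ?_, (sub_sub_cancel _ _).symm⟩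
  · have h2 : (1 - oddComm A R) α = α - (A (R α) + R (A α)) := rfl
    rw [h2, map_sub, hO _ (add_mem (hAZ _ (hRZ _)) (hRZ _)), sub_zero]
  · refine hS _ ?_
    rw [hresT]
    refine add_mem (hρS _) ?_
    exact sub_mem (hDS _ (hρS _)) (hρS _)
  · refine hEB _ ?_
    -- The element P⁻¹(res α) is in B because P maps it to res α ∈ B.
    have h1 : v (Ring.inverse (1 + oddComm D v) (res α)) ∈ B := by
      refine hvB _ (hPB _ ?_)
      rw [← Module.End.mul_apply, Ring.mul_inverse_cancel _ hP]
      exact hresB α hα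
    exact sub_mem h1 (hρB _ h1)

/-- T commutes with A and is homotopic to the identity, by R on W and by the restriction of R on C;
hence T inverts the inclusion on cohomology. -/
lemma inclusionIsQuasiIso_of_homotopy {A : Module.End ℂ W} {C : Submodule ℂ W} (hsq : A * A = 0)
    (hC : ∀ x ∈ C, A x ∈ C) {T R : Module.End ℂ W} (hT : ∀ x, T x ∈ C) (hR : ∀ x ∈ C, R x ∈ C)
    (h : oddComm A R = 1 - T) : InclusionIsQuasiIso A C := by
  have hx : ∀ x, A (R x) + R (A x) = x - T x := fun x => LinearMap.congr_fun h x
  have hAA : ∀ x, A (A x) = 0 := fun x => LinearMap.congr_fun hsq x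
  refine ⟨hsq, hC, (injective_iff_map_eq_zero _).2 fun c hc => ?_, fun c => ?_⟩
  · obtain ⟨x, rfl⟩ := Submodule.Quotient.mk_surjective _ c
    have hxC : x.1 ∈ C := x.2.1
    have hxA : A x.1 = 0 := x.2.2
    have h1 := (Submodule.Quotient.mk_eq_zero _).1 hc
    obtain ⟨y, -, hy⟩ : ∃ y ∈ (⊤ : Submodule ℂ W), A y = x.1 := h1
    refine (Submodule.Quotient.mk_eq_zero _).2 ?_
    -- If x = Ay then x = ARx + Tx and Tx = TAy = ATy, so Rx + Ty is a primitive of x inside C.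
    refine ⟨R x.1 + T y, add_mem (hR _ hxC) (hT _), ?_⟩
    have h2 := hx x.1
    have h3 := congrArg A (hx y)
    rw [hxA, map_zero, add_zero] at h2
    rw [map_add, map_sub, hAA, zero_add, hy] at h3
    change A (R x.1 + T y) = x.1
    have h4 : A (T y) = T x.1 := sub_right_inj.1 (h3.symm.trans h2)
    rw [map_add, h2, h4, sub_add_cancel]
  · obtain ⟨x, rfl⟩ := Submodule.Quotient.mk_surjective _ c
    have hxA : A x.1 = 0 := x.2.2
    have h1 := hx x.1
    rw [hxA, map_zero, add_zero] at h1
    have hT' : T x.1 = x.1 - A (R x.1) := by rw [h1, sub_sub_cancel]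
    refine ⟨Submodule.Quotient.mk ⟨T x.1, hT _, ?_⟩, ?_⟩
    · change A (T x.1) = 0
      rw [hT', map_sub, hAA, hxA, sub_zero]
    · refine (Submodule.Quotient.eq _).2 ?_
      refine ⟨-(R x.1), trivial, ?_⟩
      change A (-(R x.1)) = T x.1 - x.1
      rw [map_neg, h1, neg_sub]

/-- Downward induction on the power of N, starting from Nᵐx = 0, with Nʲx = Nʲ(1 + N)x - Nʲ⁺¹x. It
serves to keep supports compact under the inverse of 1 + [∂̄, V_f]. -/
lemma mem_of_one_add_nilpotent_apply_mem {N : Module.End ℂ W} (hN : IsNilpotent N)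
    {B : Submodule ℂ W} (hB : ∀ x ∈ B, N x ∈ B) {x : W} (hx : (1 + N) x ∈ B) : x ∈ B := by
  obtain ⟨m, hm⟩ := hN
  have hpow : ∀ (j : ℕ), ∀ x ∈ B, (N ^ j) x ∈ B := by
    intro j
    induction j with
    | zero => exact fun x hx => hx
    | succ j ih =>
      intro x hx
      rw [pow_succ, Module.End.mul_apply]
      exact ih _ (hB x hx)
  have key : ∀ j ≤ m, (N ^ (m - j)) x ∈ B := by
    intro j
    induction j with
    | zero => intro _; rw [Nat.sub_zero, hm]; exact zero_mem B
    | succ j ih =>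
      intro hj
      have h1 := hpow (m - (j + 1)) _ hx
      have h2 : (N ^ (m - (j + 1))) ((1 + N) x) = (N ^ (m - (j + 1))) x + (N ^ (m - j)) x := by
        rw [← Module.End.mul_apply, mul_add, mul_one, ← pow_succ,
          show m - (j + 1) + 1 = m - j by omega]
        rfl
      rw [h2] at h1
      exact (Submodule.add_mem_iff_left B (ih (by omega))).1 h1
  have := key m le_rfl
  rwa [Nat.sub_self] at this

end HomotopyFormula

/-! ### Power series -/

section PowerSeries

variable {V V' : Type*} [AddCommGroup V] [Module ℂ V] [AddCommGroup V'] [Module ℂ V']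

lemma coeffwise_mul (L M : Module.End ℂ V) : (coeffwise (L * M) : Module.End ℂ (Series V)) =
    coeffwise L * coeffwise M := rfl

lemma coeffwise_add (L M : Module.End ℂ V) : (coeffwise (L + M) : Module.End ℂ (Series V)) =
    coeffwise L + coeffwise M := rfl

lemma coeffwise_zero : (coeffwise (0 : Module.End ℂ V) : Module.End ℂ (Series V)) = 0 := rfl

lemma coeffwise_mul_mulU (L : Module.End ℂ V) :
    (coeffwise L * mulU : Module.End ℂ (Series V)) = mulU * coeffwise L := by
  refine LinearMap.ext fun a => funext fun m => ?_
  cases m with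
  | zero => exact map_zero L
  | succ m => rfl

lemma mem_seriesIn {C : Submodule ℂ V} {a : Series V} : a ∈ seriesIn C ↔ ∀ m, a m ∈ C := by
  simp [seriesIn, Submodule.mem_pi]

lemma coeffwise_mem {C : Submodule ℂ V} {C' : Submodule ℂ V'} {L : V →ₗ[ℂ] V'}
    (h : ∀ x ∈ C, L x ∈ C') : ∀ a ∈ seriesIn C, coeffwise L a ∈ seriesIn C' :=
  fun _ ha => mem_seriesIn.2 fun m => h _ (mem_seriesIn.1 ha m)

lemma mulU_mem {C : Submodule ℂ V} : ∀ a ∈ seriesIn C, mulU a ∈ seriesIn C := by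
  intro a ha
  refine mem_seriesIn.2 fun m => ?_
  cases m with
  | zero => exact zero_mem C
  | succ m => exact mem_seriesIn.1 ha m

lemma coeffwise_add_mulU_mem {C : Submodule ℂ V} {L M : Module.End ℂ V} (hL : ∀ x ∈ C, L x ∈ C)
    (hM : ∀ x ∈ C, M x ∈ C) :
    ∀ a ∈ seriesIn C, (coeffwise L + mulU * coeffwise M : Module.End ℂ (Series V)) a ∈ seriesIn C :=
  fun a ha => add_mem (coeffwise_mem hL a ha) (mulU_mem _ (coeffwise_mem hM a ha))

/-- The coefficients of 1, u and u² in the square are L², [L, M] and M². -/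
lemma mul_self_coeffwise_add_mulU {L M : Module.End ℂ V} (hL : L * L = 0) (hM : M * M = 0)
    (h : oddComm L M = 0) :
    (coeffwise L + mulU * coeffwise M : Module.End ℂ (Series V)) *
      (coeffwise L + mulU * coeffwise M) = 0 := by
  have h' : (coeffwise L * coeffwise M + coeffwise M * coeffwise L : Module.End ℂ (Series V)) =
      0 := by
    rw [← coeffwise_mul, ← coeffwise_mul, ← coeffwise_add]
    rw [oddComm] at h
    rw [h, coeffwise_zero]
  have hL' : (coeffwise L * coeffwise L : Module.End ℂ (Series V)) = 0 := by
    rw [← coeffwise_mul, hL, coeffwise_zero]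
  have hM' : (coeffwise M * coeffwise M : Module.End ℂ (Series V)) = 0 := by
    rw [← coeffwise_mul, hM, coeffwise_zero]
  have hu := coeffwise_mul_mulU L
  have hu' := coeffwise_mul_mulU M
  calc _ = coeffwise L * coeffwise L + (coeffwise L * mulU) * coeffwise M +
        mulU * (coeffwise M * coeffwise L) + mulU * (coeffwise M * mulU) * coeffwise M := by
          noncomm_ring
    _ = coeffwise L * coeffwise L + mulU * (coeffwise L * coeffwise M + coeffwise M * coeffwise L) +
        mulU * mulU * (coeffwise M * coeffwise M) := by rw [hu, hu']; noncomm_ring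
    _ = 0 := by rw [hL', hM', h', mul_zero, mul_zero, add_zero, add_zero]

lemma oddComm_coeffwise_add_mulU (L M v : Module.End ℂ V) :
    oddComm (coeffwise L + mulU * coeffwise M : Module.End ℂ (Series V)) (coeffwise v) =
      coeffwise (oddComm L v) + mulU * coeffwise (oddComm M v) := by
  have hu := coeffwise_mul_mulU v
  rw [oddComm, oddComm, oddComm, coeffwise_add, coeffwise_add, coeffwise_mul, coeffwise_mul,
    coeffwise_mul, coeffwise_mul, mul_add, mul_add, add_mul, ← mul_assoc (coeffwise v) mulU, hu]
  noncomm_ring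

/-- The operator is triangular in powers of u with P on the diagonal: each coefficient is found from
P a_{m+1} = c_{m+1} - M a_m. -/
lemma isUnit_coeffwise_add_mulU {P : Module.End ℂ V} (hP : IsUnit P) (M : Module.End ℂ V) :
    IsUnit (coeffwise P + mulU * coeffwise M : Module.End ℂ (Series V)) := by
  have hb := (Module.End.isUnit_iff P).1 hP
  rw [Module.End.isUnit_iff]
  refine ⟨(injective_iff_map_eq_zero _).2 fun a ha => funext fun m => ?_, fun c => ?_⟩
  · induction m with
    | zero =>
      have h : P (a 0) + 0 = 0 := congrFun ha 0
      rw [add_zero] at h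
      exact (injective_iff_map_eq_zero P).1 hb.1 _ h
    | succ m ih =>
      have h : P (a (m + 1)) + M (a m) = 0 := congrFun ha (m + 1)
      rw [ih, Pi.zero_apply, map_zero, add_zero] at h
      exact (injective_iff_map_eq_zero P).1 hb.1 _ h
  · obtain ⟨s, hs⟩ := hb.2.hasRightInverse
    -- The section s of P is only a map of sets; linearity is not needed to prove surjectivity.
    refine ⟨fun m => Nat.rec (s (c 0)) (fun m x => s (c (m + 1) - M x)) m, funext fun m => ?_⟩
    cases m with
    | zero => exact (add_zero _).trans (hs _)
    | succ m =>
      change P (s (c (m + 1) - M _)) + M _ = c (m + 1)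
      rw [hs, sub_add_cancel]

/-- The same recursion on coefficients; each coefficient has its own compact support, with no
uniform bound in u. -/
lemma mem_seriesIn_of_apply_mem {P M : Module.End ℂ V} {C : Submodule ℂ V}
    (hP : ∀ x, P x ∈ C → x ∈ C) (hM : ∀ x ∈ C, M x ∈ C) {a : Series V}
    (ha : (coeffwise P + mulU * coeffwise M : Module.End ℂ (Series V)) a ∈ seriesIn C) : a ∈ seriesIn C := by
  rw [mem_seriesIn] at ha ⊢
  intro m
  induction m with
  | zero =>
    have h : P (a 0) + 0 ∈ C := ha 0
    rw [add_zero] at h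
    exact hP _ h
  | succ m ih =>
    have h : P (a (m + 1)) + M (a m) ∈ C := ha (m + 1)
    exact hP _ ((Submodule.add_mem_iff_left C (hM _ ih)).1 h)

lemma one_add_oddComm_coeffwise_add_mulU (L M v : Module.End ℂ V) :
    1 + oddComm (coeffwise L + mulU * coeffwise M : Module.End ℂ (Series V)) (coeffwise v) =
      coeffwise (1 + oddComm L v) + mulU * coeffwise (oddComm M v) := by
  rw [oddComm_coeffwise_add_mulU, ← add_assoc]
  rfl

lemma isUnit_one_add_oddComm_coeffwise {L v : Module.End ℂ V} (h : IsUnit (1 + oddComm L v))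
    (M : Module.End ℂ V) : IsUnit
      (1 + oddComm (coeffwise L + mulU * coeffwise M : Module.End ℂ (Series V)) (coeffwise v)) := by
  rw [one_add_oddComm_coeffwise_add_mulU]
  exact isUnit_coeffwise_add_mulU h _

lemma isUnit_one_add_of_isNilpotent {N : Module.End ℂ V} (h : IsNilpotent N) : IsUnit (1 + N) :=
  h.isUnit_one_add

/-- The homotopy with a formal parameter. -/
lemma exists_homotopy_series {X : Type*} [AddCommGroup X] [Module ℂ X]
    {D b v ρ χ δ' : Module.End ℂ V'} {A δ : Module.End ℂ V}
    (res : V →ₗ[ℂ] V') (E : V' →ₗ[ℂ] V) (O : V →ₗ[ℂ] X) (C Z : Submodule ℂ V)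
    (B S : Submodule ℂ V')
    (hsq : (D + b) * (D + b) = 0) (hδ' : δ' * δ' = 0) (hDδ : oddComm (D + b) δ' = 0)
    (hbv : oddComm b v = 1) (hbρ : Commute b ρ) (hP : IsUnit (1 + oddComm D v))
    (hres : ∀ α, res (A α) = (D + b) (res α)) (hresδ : ∀ α, res (δ α) = δ' (res α))
    (hE : res ∘ₗ E = χ) (hχ : χ * (1 - ρ) = 1 - ρ)
    (hO : ∀ α ∈ Z, O α = 0) (hAZ : ∀ α ∈ Z, A α ∈ Z) (hδZ : ∀ α ∈ Z, δ α ∈ Z)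
    (hEZ : ∀ β, E β ∈ Z)
    (hS : ∀ α, res α ∈ S → α ∈ C) (hρS : ∀ β, ρ β ∈ S) (hDS : ∀ β ∈ S, D β ∈ S)
    (hδS : ∀ β ∈ S, δ' β ∈ S)
    (hresB : ∀ α ∈ C, res α ∈ B) (hEB : ∀ β ∈ B, E β ∈ C) (hvB : ∀ β ∈ B, v β ∈ B)
    (hρB : ∀ β ∈ B, ρ β ∈ B) (hδvB : ∀ β ∈ B, oddComm δ' v β ∈ B)
    (hPB : ∀ β, (1 + oddComm D v) β ∈ B → β ∈ B) :
    ∃ T R : Module.End ℂ (Series V),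
      (∀ α, coeffwise res (T α) = formulaT (coeffwise D + mulU * coeffwise δ') (coeffwise v)
        (coeffwise ρ) (coeffwise res α)) ∧
      (∀ α, coeffwise res (R α) = formulaR (coeffwise D + mulU * coeffwise δ') (coeffwise v)
        (coeffwise ρ) (coeffwise res α)) ∧
      (∀ α m, O (T α m) = O (α m)) ∧ (∀ α m, O (R α m) = 0) ∧
      (∀ α, T α ∈ seriesIn C) ∧ (∀ α ∈ seriesIn C, R α ∈ seriesIn C) ∧
      oddComm (coeffwise A + mulU * coeffwise δ) R = 1 - T := by
  -- The term uδ' is grouped with D, so that b alone still satisfies [b, v] = 1 and commutes with ρ.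
  have hsum : (coeffwise D + mulU * coeffwise δ' + coeffwise b : Module.End ℂ (Series V')) =
      coeffwise (D + b) + mulU * coeffwise δ' := by
    rw [coeffwise_add, add_right_comm]
  have hbv' : oddComm (coeffwise b : Module.End ℂ (Series V')) (coeffwise v) = 1 :=
    congrArg (coeffwise (V := V')) hbv
  have hbρ' : Commute (coeffwise b : Module.End ℂ (Series V')) (coeffwise ρ) :=
    congrArg (coeffwise (V := V')) hbρ.eq
  have hP' := isUnit_one_add_oddComm_coeffwise hP δ'
  have hres' : ∀ α, coeffwise res
      ((coeffwise A + mulU * coeffwise δ : Module.End ℂ (Series V)) α) =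
      (coeffwise D + mulU * coeffwise δ' + coeffwise b : Module.End ℂ (Series V'))
        (coeffwise res α) := by
    intro α
    rw [hsum]
    funext m
    cases m with
    | zero =>
      change res (A (α 0) + 0) = (D + b) (res (α 0)) + 0
      rw [map_add, hres, map_zero]
    | succ m =>
      change res (A (α (m + 1)) + δ (α m)) = (D + b) (res (α (m + 1))) + δ' (res (α m))
      rw [map_add, hres, hresδ]
  obtain ⟨T, R, h1, h2, h3, h4, h5, h6, h7⟩ := exists_homotopy (coeffwise res) (coeffwise E)
    (coeffwise O) (seriesIn C) (seriesIn Z) (seriesIn B) (seriesIn S)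
    (by rw [hsum]; exact mul_self_coeffwise_add_mulU hsq hδ' hDδ) hbv'
    hbρ' hP' hres' (congrArg coeffwise hE)
    (congrArg (coeffwise (V := V')) hχ)
    (fun α hα => funext fun m => hO _ (mem_seriesIn.1 hα m)) (coeffwise_add_mulU_mem hAZ hδZ)
    (fun β => mem_seriesIn.2 fun m => hEZ _)
    (fun α hα => mem_seriesIn.2 fun m => hS _ (mem_seriesIn.1 hα m))
    (fun β => mem_seriesIn.2 fun m => hρS _) (coeffwise_add_mulU_mem hDS hδS)
    (coeffwise_mem hresB) (coeffwise_mem hEB) (coeffwise_mem hvB) (coeffwise_mem hρB)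
    (fun β hβ => mem_seriesIn_of_apply_mem hPB hδvB
      (by rwa [one_add_oddComm_coeffwise_add_mulU] at hβ))
  exact ⟨T, R, h1, h2, fun α m => congrFun (h3 α) m, fun α m => congrFun (h4 α) m, h5, h6, h7⟩

end PowerSeries

/-! ### Cut-off functions -/

section Cutoff

variable {d : ℕ}

lemma exists_compactSupport_eq_one : ∃ r : (Fin d → ℂ) → ℝ, ContDiff ℝ ∞ r ∧
    HasCompactSupport r ∧ ∀ᶠ z in nhds 0, r z = 1 := by
  let b : ContDiffBump (0 : Fin d → ℂ) := ⟨1, 2, by norm_num, by norm_num⟩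
  exact ⟨b, b.contDiff, b.hasCompactSupport, b.eventuallyEq_one⟩

lemma exists_cutoff {r : (Fin d → ℂ) → ℝ} (h : ∀ᶠ z in nhds 0, r z = 1) :
    ∃ χ : (Fin d → ℂ) → ℝ, ContDiff ℝ ∞ χ ∧ (∀ᶠ z in nhds 0, χ z = 0) ∧
      ∀ z, χ z * (1 - r z) = 1 - r z := by
  obtain ⟨ε, hε, hr⟩ := Metric.eventually_nhds_iff_ball.1 h
  -- The bump equals 1 near 0 and vanishes off the ball of radius ε, inside which r = 1; so χ = 1 -
  -- b is 1 wherever 1 - r is nonzero.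
  let b : ContDiffBump (0 : Fin d → ℂ) := ⟨ε / 2, ε, by linarith, by linarith⟩
  refine ⟨fun z => 1 - b z, contDiff_const.sub b.contDiff, ?_, fun z => ?_⟩
  · filter_upwards [b.eventuallyEq_one] with z hz
    rw [hz, Pi.one_apply, sub_self]
  · by_cases hz : z ∈ Metric.ball 0 ε
    · rw [hr z hz, sub_self, mul_zero]
    · have : b z = 0 := by
        have h' : z ∉ Function.support b := by rwa [b.support_eq]
        exact Function.notMem_support.1 h'
      change (1 - b z) * (1 - r z) = 1 - r z
      rw [this, sub_zero, one_mul]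

end Cutoff

/-! ### The homotopies on the central fibre -/

section CentralFibre

variable {n d : ℕ} (F : ProjFan n d)

lemma isUnit_one_add_dbar_anticomm_Vf :
    IsUnit (1 + oddComm (dbar F (punctured d)) (Vf F)) :=
  isUnit_one_add_of_isNilpotent (isNilpotent_dbar_anticomm_Vf F)

lemma isUnit_one_add_Q_anticomm_Vf :
    IsUnit (1 + oddComm (Q F (punctured d)) (coeffwise (Vf F))) :=
  isUnit_one_add_oddComm_coeffwise (isUnit_one_add_dbar_anticomm_Vf F) _

lemma Qf_mul_self (Ω : TopologicalSpace.Opens (Fin d → ℂ)) : Qf F Ω * Qf F Ω = 0 :=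
  mul_self_coeffwise_add_mulU (dbarF_mul_self F Ω) (del_mul_self F Ω) (dbarF_anticomm_del F Ω)

lemma dbarF_mem_PVc : ∀ α ∈ PVc F, dbarF F ⊤ α ∈ PVc F := by
  rw [PVc_eq_boundedSupport]
  exact (supportLocal_dbarF F ⊤).map_boundedSupport

lemma del_mem_PVc : ∀ α ∈ PVc F, del F ⊤ α ∈ PVc F := by
  rw [PVc_eq_boundedSupport]
  exact (supportLocal_del F ⊤).map_boundedSupport

/-- [∂̄, V_f] is nilpotent and does not enlarge supports, so a bound on the support passes back
through 1 + [∂̄, V_f]. -/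
lemma mem_boundedSupport_of_one_add_apply_mem {β : PV F (punctured d)}
    (h : (1 + oddComm (dbar F (punctured d)) (Vf F)) β ∈ boundedSupport F (punctured d)) :
    β ∈ boundedSupport F (punctured d) :=
  mem_of_one_add_nilpotent_apply_mem (isNilpotent_dbar_anticomm_Vf F)
    ((supportLocal_dbar F _).oddComm (supportLocal_Vf F)).map_boundedSupport h

lemma notMem_tsupport_of_eventually_eq_zero {χ : (Fin d → ℂ) → ℝ}
    (h0 : ∀ᶠ z in nhds 0, χ z = 0) : (0 : Fin d → ℂ) ∉ tsupport χ :=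
  notMem_tsupport_iff_eventuallyEq.2 h0

lemma zero_mem_tsupport {r : (Fin d → ℂ) → ℝ} (h1 : ∀ᶠ z in nhds 0, r z = 1) :
    (0 : Fin d → ℂ) ∈ tsupport r :=
  subset_tsupport r (by rw [Function.mem_support, h1.self_of_nhds]; exact one_ne_zero)

lemma mem_PVc_of_toPunctured {r : (Fin d → ℂ) → ℝ} (hc : HasCompactSupport r)
    (h1 : ∀ᶠ z in nhds 0, r z = 1) {α : PV F ⊤}
    (h : toPunctured F α ∈ supportedIn F (punctured d) (tsupport r)) : α ∈ PVc F :=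
  mem_PVc_of_mem_boundedSupport
    ⟨tsupport r, hc, mem_supportedIn_of_toPunctured (zero_mem_tsupport h1) h⟩

lemma toPunctured_mem_boundedSupport : ∀ α ∈ PVc F,
    toPunctured F α ∈ boundedSupport F (punctured d) := by
  rw [PVc_eq_boundedSupport]
  exact (supportLocal_toPunctured F).map_boundedSupport

lemma extendBy_mem_PVc (χ : (Fin d → ℂ) → ℝ) (hχ : ContDiff ℝ ∞ χ)
    (h0 : ∀ᶠ z in nhds 0, χ z = 0) : ∀ β ∈ boundedSupport F (punctured d),
    extendBy F χ hχ h0 β ∈ PVc F := by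
  rw [PVc_eq_boundedSupport]
  exact (supportLocal_extendBy F χ hχ h0).map_boundedSupport

lemma toPunctured_dbarF (α : PV F ⊤) : toPunctured F (dbarF F ⊤ α) =
    (dbar F (punctured d) + bracketF F (punctured d)) (toPunctured F α) := by
  change toPunctured F (dbar F ⊤ α + bracketF F ⊤ α) = _
  rw [map_add, toPunctured_dbar, toPunctured_bracketF]
  rfl

/-- The operators `T_ρ` and `R_ρ`. -/
lemma exists_homotopy_dbarF (r : (Fin d → ℂ) → ℝ) (hr : ContDiff ℝ ∞ r)
    (hc : HasCompactSupport r) (h1 : ∀ᶠ z in nhds 0, r z = 1) :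
    ∃ T R : Module.End ℂ (PV F ⊤),
      (∀ α, toPunctured F (T α) = formulaT (dbar F (punctured d)) (Vf F)
        (mulBy F (punctured d) r hr) (toPunctured F α)) ∧
      (∀ α, toPunctured F (R α) = formulaR (dbar F (punctured d)) (Vf F)
        (mulBy F (punctured d) r hr) (toPunctured F α)) ∧
      (∀ α, atOrigin F (T α) = atOrigin F α) ∧ (∀ α, atOrigin F (R α) = 0) ∧
      (∀ α, T α ∈ PVc F) ∧ (∀ α ∈ PVc F, R α ∈ PVc F) ∧ oddComm (dbarF F ⊤) R = 1 - T := by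
  obtain ⟨χ, hχ, h0, hχr⟩ := exists_cutoff h1
  -- The closed set supp χ misses the origin, so fields supported in it have value zero there, and
  -- this is stable under local operators.
  refine exists_homotopy (A := dbarF F ⊤) (b := bracketF F (punctured d))
    (χ := mulBy F (punctured d) χ hχ)
    (toPunctured F) (extendBy F χ hχ h0) (atOrigin F) (PVc F)
    (supportedIn F ⊤ (tsupport χ)) (boundedSupport F (punctured d))
    (supportedIn F (punctured d) (tsupport r))
    ?_ ?_ ?_ ?_ ?_ ?_ ?_ ?_ ?_ ?_ ?_ ?_ ?_ ?_ ?_ ?_ ?_ ?_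
  · exact dbarF_mul_self F (punctured d)
  · exact bracketF_anticomm_Vf F
  · exact bracketF_commute_mulBy F _ r hr
  · exact isUnit_one_add_dbar_anticomm_Vf F
  · exact toPunctured_dbarF F
  · exact toPunctured_comp_extendBy F χ hχ h0
  · exact mulBy_mul_one_sub F _ χ hχ r hr hχr
  · exact fun α => atOrigin_eq_zero (notMem_tsupport_of_eventually_eq_zero h0)
  · exact supportLocal_dbarF F ⊤ _ (isClosed_tsupport χ)
  · exact extendBy_mem_supportedIn F χ hχ h0
  · exact fun α => mem_PVc_of_toPunctured F hc h1
  · exact mulBy_mem_supportedIn F _ r hr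
  · exact supportLocal_dbar F _ _ (isClosed_tsupport r)
  · exact toPunctured_mem_boundedSupport F
  · exact extendBy_mem_PVc F χ hχ h0
  · exact (supportLocal_Vf F).map_boundedSupport
  · exact (supportLocal_mulBy F _ r hr).map_boundedSupport
  · exact fun β => mem_boundedSupport_of_one_add_apply_mem F

set_option maxHeartbeats 1000000 in
/-- The operators `T_ρ^u` and `R_ρ^u`. -/
lemma exists_homotopy_Qf (r : (Fin d → ℂ) → ℝ) (hr : ContDiff ℝ ∞ r)
    (hc : HasCompactSupport r) (h1 : ∀ᶠ z in nhds 0, r z = 1) :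
    ∃ T R : Module.End ℂ (Series (PV F ⊤)),
      (∀ α, coeffwise (toPunctured F) (T α) = formulaT (Q F (punctured d)) (coeffwise (Vf F))
        (coeffwise (mulBy F (punctured d) r hr)) (coeffwise (toPunctured F) α)) ∧
      (∀ α, coeffwise (toPunctured F) (R α) = formulaR (Q F (punctured d)) (coeffwise (Vf F))
        (coeffwise (mulBy F (punctured d) r hr)) (coeffwise (toPunctured F) α)) ∧
      (∀ α m, atOrigin F (T α m) = atOrigin F (α m)) ∧ (∀ α m, atOrigin F (R α m) = 0) ∧
      (∀ α, T α ∈ seriesIn (PVc F)) ∧ (∀ α ∈ seriesIn (PVc F), R α ∈ seriesIn (PVc F)) ∧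
      oddComm (Qf F ⊤) R = 1 - T := by
  obtain ⟨χ, hχ, h0, hχr⟩ := exists_cutoff h1
  refine exists_homotopy_series (A := dbarF F ⊤) (δ := del F ⊤) (D := dbar F (punctured d))
    (b := bracketF F (punctured d)) (v := Vf F) (ρ := mulBy F (punctured d) r hr)
    (χ := mulBy F (punctured d) χ hχ) (δ' := del F (punctured d))
    (toPunctured F) (extendBy F χ hχ h0) (atOrigin F) (PVc F)
    (supportedIn F ⊤ (tsupport χ)) (boundedSupport F (punctured d))
    (supportedIn F (punctured d) (tsupport r))
    ?_ ?_ ?_ ?_ ?_ ?_ ?_ ?_ ?_ ?_ ?_ ?_ ?_ ?_ ?_ ?_ ?_ ?_ ?_ ?_ ?_ ?_ ?_ ?_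
  · exact dbarF_mul_self F (punctured d)
  · exact del_mul_self F (punctured d)
  · exact dbarF_anticomm_del F (punctured d)
  · exact bracketF_anticomm_Vf F
  · exact bracketF_commute_mulBy F _ r hr
  · exact isUnit_one_add_dbar_anticomm_Vf F
  · exact toPunctured_dbarF F
  · exact toPunctured_del F
  · exact toPunctured_comp_extendBy F χ hχ h0
  · exact mulBy_mul_one_sub F _ χ hχ r hr hχr
  · exact fun α => atOrigin_eq_zero (notMem_tsupport_of_eventually_eq_zero h0)
  · exact supportLocal_dbarF F ⊤ _ (isClosed_tsupport χ)
  · exact supportLocal_del F ⊤ _ (isClosed_tsupport χ)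
  · exact extendBy_mem_supportedIn F χ hχ h0
  · exact fun α => mem_PVc_of_toPunctured F hc h1
  · exact mulBy_mem_supportedIn F _ r hr
  · exact supportLocal_dbar F _ _ (isClosed_tsupport r)
  · exact supportLocal_del F _ _ (isClosed_tsupport r)
  · exact toPunctured_mem_boundedSupport F
  · exact extendBy_mem_PVc F χ hχ h0
  · exact (supportLocal_Vf F).map_boundedSupport
  · exact (supportLocal_mulBy F _ r hr).map_boundedSupport
  · exact ((supportLocal_del F _).oddComm (supportLocal_Vf F)).map_boundedSupport
  · exact fun β => mem_boundedSupport_of_one_add_apply_mem F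

/-- One choice of cut-off function suffices: cohomology does not see which homotopy is used. -/
lemma inclusionIsQuasiIso_dbarF : InclusionIsQuasiIso (dbarF F ⊤) (PVc F) := by
  obtain ⟨r, hr, hc, h1⟩ := exists_compactSupport_eq_one (d := d)
  obtain ⟨T, R, -, -, -, -, hT, hR, h⟩ := exists_homotopy_dbarF F r hr hc h1
  refine inclusionIsQuasiIso_of_homotopy (T := T) (R := R) ?_ ?_ hT hR h
  · exact dbarF_mul_self F ⊤
  · exact dbarF_mem_PVc F

lemma inclusionIsQuasiIso_Qf : InclusionIsQuasiIso (Qf F ⊤) (seriesIn (PVc F)) := by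
  obtain ⟨r, hr, hc, h1⟩ := exists_compactSupport_eq_one (d := d)
  obtain ⟨T, R, -, -, -, -, hT, hR, h⟩ := exists_homotopy_Qf F r hr hc h1
  refine inclusionIsQuasiIso_of_homotopy (T := T) (R := R) ?_ ?_ hT hR h
  · exact Qf_mul_self F ⊤
  · exact coeffwise_add_mulU_mem (dbarF_mem_PVc F) (del_mem_PVc F)

end CentralFibre

end

end LogLG

theorem mainTheorem11 {n d : ℕ} (F : LogLG.ProjFan n d) :
    -- the two inclusions are quasi-isomorphisms
    LogLG.InclusionIsQuasiIso (LogLG.dbarF F ⊤) (LogLG.PVc F) ∧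
    LogLG.InclusionIsQuasiIso (LogLG.Qf F ⊤) (LogLG.seriesIn (LogLG.PVc F)) ∧
    -- `[{f, -}, V_f] = 1` on `X ∖ {0}`
    LogLG.oddComm (LogLG.bracketF F (LogLG.punctured d)) (LogLG.Vf F) = 1 ∧
    -- the operators `1 + [∂̄, V_f]` and `1 + [Q, V_f]` are invertible over `X ∖ {0}`
    IsUnit (1 + LogLG.oddComm (LogLG.dbar F (LogLG.punctured d)) (LogLG.Vf F)) ∧
    IsUnit (1 + LogLG.oddComm (LogLG.Q F (LogLG.punctured d)) (LogLG.coeffwise (LogLG.Vf F))) ∧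
    ∀ (ρ : (Fin d → ℂ) → ℝ) (hρ : ContDiff ℝ ∞ ρ), HasCompactSupport ρ →
      (∀ᶠ z in nhds 0, ρ z = 1) →
      -- the operators `T_ρ`, `R_ρ` on `PV_log(X)`
      (∃ T R : Module.End ℂ (LogLG.PV F ⊤),
        (∀ α, LogLG.toPunctured F (T α) =
          LogLG.formulaT (LogLG.dbar F (LogLG.punctured d)) (LogLG.Vf F)
            (LogLG.mulBy F (LogLG.punctured d) ρ hρ) (LogLG.toPunctured F α)) ∧
        (∀ α, LogLG.toPunctured F (R α) =
          LogLG.formulaR (LogLG.dbar F (LogLG.punctured d)) (LogLG.Vf F)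
            (LogLG.mulBy F (LogLG.punctured d) ρ hρ) (LogLG.toPunctured F α)) ∧
        (∀ α, LogLG.atOrigin F (T α) = LogLG.atOrigin F α) ∧
        (∀ α, LogLG.atOrigin F (R α) = 0) ∧
        (∀ α, T α ∈ LogLG.PVc F) ∧
        (∀ α ∈ LogLG.PVc F, R α ∈ LogLG.PVc F) ∧
        LogLG.oddComm (LogLG.dbarF F ⊤) R = 1 - T) ∧
      -- the operators `T_ρ^u`, `R_ρ^u` on `PV_log(X)[[u]]`
      (∃ T R : Module.End ℂ (LogLG.Series (LogLG.PV F ⊤)),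
        (∀ α, LogLG.coeffwise (LogLG.toPunctured F) (T α) =
          LogLG.formulaT (LogLG.Q F (LogLG.punctured d)) (LogLG.coeffwise (LogLG.Vf F))
            (LogLG.coeffwise (LogLG.mulBy F (LogLG.punctured d) ρ hρ))
            (LogLG.coeffwise (LogLG.toPunctured F) α)) ∧
        (∀ α, LogLG.coeffwise (LogLG.toPunctured F) (R α) =
          LogLG.formulaR (LogLG.Q F (LogLG.punctured d)) (LogLG.coeffwise (LogLG.Vf F))
            (LogLG.coeffwise (LogLG.mulBy F (LogLG.punctured d) ρ hρ))
            (LogLG.coeffwise (LogLG.toPunctured F) α)) ∧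
        (∀ α m, LogLG.atOrigin F (T α m) = LogLG.atOrigin F (α m)) ∧
        (∀ α m, LogLG.atOrigin F (R α m) = 0) ∧
        (∀ α, T α ∈ LogLG.seriesIn (LogLG.PVc F)) ∧
        (∀ α ∈ LogLG.seriesIn (LogLG.PVc F), R α ∈ LogLG.seriesIn (LogLG.PVc F)) ∧
        LogLG.oddComm (LogLG.Qf F ⊤) R = 1 - T) := by
  refine ⟨LogLG.inclusionIsQuasiIso_dbarF F, LogLG.inclusionIsQuasiIso_Qf F,
    LogLG.bracketF_anticomm_Vf F, LogLG.isUnit_one_add_dbar_anticomm_Vf F,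
    LogLG.isUnit_one_add_Q_anticomm_Vf F, fun ρ hρ hc h1 => ⟨?_, ?_⟩⟩
  · exact LogLG.exists_homotopy_dbarF F ρ hρ hc h1
  · exact LogLG.exists_homotopy_Qf F ρ hρ hc h1
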